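/- **Setting.** Let $\mathcal B$ be a unital complex algebra and $(\mathcal A,\varphi,\psi,\mathcal B)$ a conditional operator-valued probability space: $\mathcal A$ is a unital complex algebra with a unital algebra homomorphism $\mathcal B\to\mathcal A$, and $\varphi,\psi:\mathcal A\to\mathcal B$ are linear $\mathcal B$-bimodule maps with $\varphi(1)=\psi(1)=1$. Elements $a,b\in\mathcal A$ are *conditionally free* if for all $n\ge1$ and all $p_1,\dots,p_n$ with $\psi(p_j)=0$, taken alternately from the subalgebras generated by $\mathcal B\cup\{a\}$ and by $\mathcal B\cup\{b\}$, one has $\psi(p_1\cdots p_n)=0$ and $\varphi(p_1\cdots p_n)=\varphi(p_1)\cdots\varphi(p_n)$. **Cumulants.** The free cumulants $\kappa_n$ and the conditionally free cumulants $\kappa_n^c$ are the maps $\mathcal A^n\to\mathcal B$ determined by the moment-cumulant relations $$\varphi(a_1\cdots a_n)=\sum_{V=\{1=v_1<\dots<v_k\}\subseteq\{1,\dots,n\}}\kappa^c_k\big(a_{v_1}\psi(w_1),\dots,a_{v_{k-1}}\psi(w_{k-1}),a_{v_k}\big)\,\varphi(w_k)$$ (where $w_j$ is the product of the $a_i$ with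 $v_j<i<v_{j+1}$, and $w_k$ that of the $a_i$ with $i>v_k$), and by the same relations with $\psi,\kappa$ in place of $\varphi,\kappa^c$. For $x\in\mathcal A$ let $K_x$, $K_x^c$ be the multilinear function series over $\mathcal B$ with components $K_x^{(n)}(b_1,\dots,b_n)=\kappa_{n+1}(xb_1,\dots,xb_n,x)$ and $K_x^{c,(n)}(b_1,\dots,b_n)=\kappa^c_{n+1}(xb_1,\dots,xb_n,x)$, $n\ge0$. **Series.** Let $G$ be the group of multilinear function series over $\mathcal B$ with constant term $1$, with the Cauchy product $(A\centerdot B)(b_1,\dots,b_n)=\sum_{i=0}^n A(b_1,\dots,b_i)B(b_{i+1},\dots,b_n)$; let $\Gamma$ be the group of multilinear function series with zero constant term and degree-one term $I=\mathrm{id}_{\mathcal B}$, with the composition product $\circ$. $\Gamma$ acts on $G$ on the right by automorphisms, $(1+\alpha)\cdot\beta=1+\alpha\circ\beta$. Let $\boldsymbol\lambda(A)=I\centerdot A$ and $\boldsymbol\rho(A)=A\centerdot I$. A map $\mathbf T:G\to\Gamma$ is an $\mathcal O$-group operator if $\mathbf T(g)\mathbf T(h)=\mathbf T((g\cdot\mathbf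 T(h))h)$. Then $\boldsymbol\rho$ is an $\mathcal O$-group operator on $G$, and $\boldsymbol\lambda$ is one on the opposite group $G^{op}$. For such $\mathbf T$ put $g\cdot_{\mathbf T}h=g\cdot\mathbf T(h)$ and $g\star_{\mathbf T}h=(g\cdot\mathbf T(h))h$; the crossed product group $\ltimes_{\mathbf T}$ on pairs is $$(k_1,h_1)\ltimes_{\mathbf T}(k_2,h_2)=\big(k_1\star_{\mathbf T}k_2,\;(h_1\cdot_{\mathbf T}k_2)h_2\big),$$ and $e_{\mathbf T|\varepsilon}(k,h)=\big((k^{-1},h^{-1})\big)^{-1^{\ltimes_{\mathbf T}}}$. For maps $S,\mathbf T:G\to\Gamma$ put $(S\#\mathbf T)(g)=S(g\cdot\mathbf T(g)^{-1})\,\mathbf T(g)$; the $\#$-inverse of $\boldsymbol\lambda$ is $\boldsymbol\lambda^{-1^\#}(A)=I\centerdot A^{-1}$, and $\boldsymbol\lambda^{-1^\#}\#\boldsymbol\rho:A\mapsto A\centerdot I\centerdot A^{-1}$ is an $\mathcal O$-group operator on $G$. **Theorem.** Let $a,b\in\mathcal A$ be conditionally free with $\varphi(a)=\varphi(b)=\psi(a)=\psi(b)=1$.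 For each $x\in\{a,b,ab\}$ there is a unique pair $(T_x,T_x^c)\in G\times G$ with $$(K_x,K_x^c)=e_{\boldsymbol\lambda|\varepsilon}(T_x,T_x^c)$$ (here $\boldsymbol\lambda$ is regarded as an $\mathcal O$-group operator on $G^{op}$), and these pairs satisfy $$(T_{ab},T_{ab}^c)=(T_a,T_a^c)\ltimes_{\boldsymbol\lambda^{-1^\#}\#\boldsymbol\rho}(T_b,T_b^c)=\Big(T_a\star_{\boldsymbol\lambda^{-1^\#}\#\boldsymbol\rho}T_b,\;(T_a^c\cdot_{\boldsymbol\lambda^{-1^\#}\#\boldsymbol\rho}T_b)\centerdot T_b^c\Big).$$ -/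

import Mathlib

open scoped RightActions

namespace CFree

/-! ## Right group modules, `O`-group operators, the product `#`, crossed products

A right group module `(G, ·, Γ)` is a pair of groups with a right action of `Γ` on `G` by
automorphisms, i.e. an instance of `MulDistribMulAction Γᵐᵒᵖ G`; `g <• γ` is the action
of `γ` on `g`. -/

section GroupModule

/-- An `O`-group operator on a right group module: `T(g) T(h) = T((g · T(h)) h)`. -/
structure OGroupOperator (G Γ : Type*) [Group G] [Group Γ] [MulDistribMulAction Γᵐᵒᵖ G] where
  toFun : G → Γ
  map_star : ∀ g h : G, toFun g * toFun h = toFun ((g <• toFun h) * h)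

variable {G Γ : Type*} [Group G] [Group Γ] [MulDistribMulAction Γᵐᵒᵖ G]

instance : CoeFun (OGroupOperator G Γ) (fun _ => G → Γ) := ⟨OGroupOperator.toFun⟩

/-- The product `g ⋆_T h = (g · T(h)) h`. -/
def OGroupOperator.star (T : OGroupOperator G Γ) (g h : G) : G := (g <• T h) * h

theorem OGroupOperator.map_one (T : OGroupOperator G Γ) : T 1 = 1 := by
  have h := T.map_star 1 1
  simp only [smul_one, mul_one] at h
  simpa using h

/-- The product `#` of two maps `G → Γ`: `(A # B)(g) = A(g · B(g)⁻¹) B(g)`. -/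
def sharp (A B : G → Γ) (g : G) : Γ := A (g <• (B g)⁻¹) * B g

/-- For an `O`-group operator `T` on the opposite group of `G`, the map `g ↦ T(g⁻¹)`, which is an
`O`-group operator on `G`. It is the inverse of `T` for the product `#`, see `sharp_sharpInv` and
`sharpInv_sharp`. -/
def OGroupOperator.sharpInv (T : OGroupOperator Gᵐᵒᵖ Γ) : OGroupOperator G Γ where
  toFun g := T (MulOpposite.op g⁻¹)
  map_star g h := by
    rw [T.map_star]
    congr 1
    apply MulOpposite.unop_injective
    simp [smul_inv']

theorem sharpInv_sharp (T : OGroupOperator Gᵐᵒᵖ Γ) :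
    sharp (T.sharpInv : G → Γ) (fun g => T (MulOpposite.op g)) = fun _ => 1 := by
  funext g
  have h := T.map_star (MulOpposite.op (g⁻¹ <• (T (MulOpposite.op g))⁻¹)) (MulOpposite.op g)
  have e : (MulOpposite.op (g⁻¹ <• (T (MulOpposite.op g))⁻¹) <• T (MulOpposite.op g)) *
      MulOpposite.op g = 1 := by
    apply MulOpposite.unop_injective
    simp [smul_smul]
  rw [e, T.map_one] at h
  simpa [sharp, OGroupOperator.sharpInv, smul_inv'] using h

theorem sharp_sharpInv (T : OGroupOperator Gᵐᵒᵖ Γ) :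
    sharp (fun g => T (MulOpposite.op g)) (T.sharpInv : G → Γ) = fun _ => 1 := by
  funext g
  have h := T.map_star (MulOpposite.op (g <• (T (MulOpposite.op g⁻¹))⁻¹)) (MulOpposite.op g⁻¹)
  have e : (MulOpposite.op (g <• (T (MulOpposite.op g⁻¹))⁻¹) <• T (MulOpposite.op g⁻¹)) *
      MulOpposite.op g⁻¹ = 1 := by
    apply MulOpposite.unop_injective
    simp [smul_smul]
  rw [e, T.map_one] at h
  simpa [sharp, OGroupOperator.sharpInv] using h

/-- The crossed product group `G_T ⋉ G` of an `O`-group operator `T`, with product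
`(k₁, h₁) (k₂, h₂) = (k₁ ⋆_T k₂, (h₁ · T(k₂)) h₂)`. -/
@[ext]
structure Crossed (T : OGroupOperator G Γ) where
  base : G
  fiber : G

namespace Crossed

variable {T : OGroupOperator G Γ}

instance : Mul (Crossed T) := ⟨fun p q => ⟨T.star p.base q.base, (p.fiber <• T q.base) * q.fiber⟩⟩
instance : One (Crossed T) := ⟨⟨1, 1⟩⟩
instance : Inv (Crossed T) :=
  ⟨fun p => ⟨p.base⁻¹ <• (T p.base)⁻¹, p.fiber⁻¹ <• (T p.base)⁻¹⟩⟩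

@[simp] theorem mul_base (p q : Crossed T) : (p * q).base = (p.base <• T q.base) * q.base := rfl
@[simp] theorem mul_fiber (p q : Crossed T) :
    (p * q).fiber = (p.fiber <• T q.base) * q.fiber := rfl
@[simp] theorem one_base : (1 : Crossed T).base = 1 := rfl
@[simp] theorem one_fiber : (1 : Crossed T).fiber = 1 := rfl
@[simp] theorem inv_base (p : Crossed T) : p⁻¹.base = p.base⁻¹ <• (T p.base)⁻¹ := rfl
@[simp] theorem inv_fiber (p : Crossed T) : p⁻¹.fiber = p.fiber⁻¹ <• (T p.base)⁻¹ := rfl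

theorem T_inv (g : G) : T (g⁻¹ <• (T g)⁻¹) = (T g)⁻¹ := by
  rw [eq_inv_iff_mul_eq_one, T.map_star]
  simp [smul_smul, T.map_one]

instance : Group (Crossed T) :=
  Group.ofLeftAxioms
    (by
      intro p q r
      ext <;> simp [mul_assoc, smul_smul, ← T.map_star])
    (by intro p; ext <;> simp)
    (by
      intro p
      ext <;> simp [smul_smul])

end Crossed

/-- The relative transform `e_{T|ε}(k, h) = ((k, h)⁻¹)^{-1}`, where the inner inverse is taken in
`G × G` and the outer one in the crossed product `G_T ⋉ G`. -/
def relativeTransform (T : OGroupOperator G Γ) (p : G × G) : Crossed T :=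
  (⟨p.1⁻¹, p.2⁻¹⟩ : Crossed T)⁻¹

end GroupModule

/-! ## Multilinear function series

A multilinear function series `α = ∑ α⁽ⁿ⁾`, `α⁽ⁿ⁾ : Bⁿ → B`, over an algebra `B` is encoded by the
function `List B → B` sending `[b₁, …, bₙ]` to `α⁽ⁿ⁾(b₁, …, bₙ)`. -/

section Series

set_option linter.unusedSectionVars false

variable {B : Type*} [Ring B] [Algebra ℂ B]

/-- Multilinearity: `f` is `ℂ`-linear in each entry of the list. -/
def IsMultilinear (f : List B → B) : Prop :=
  (∀ l r x y, f (l ++ (x + y) :: r) = f (l ++ x :: r) + f (l ++ y :: r)) ∧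
  ∀ (c : ℂ) (l r x), f (l ++ (c • x) :: r) = c • f (l ++ x :: r)

/-- The sum of `H u v` over all ways `l = u ++ v` of cutting the list `l` into two pieces. -/
def splitSum {X M : Type*} [AddCommMonoid M] : (List X → List X → M) → List X → M
  | H, [] => H [] []
  | H, x :: l => H [] (x :: l) + splitSum (fun u v => H (x :: u) v) l

/-- The Cauchy product:
`(f.g)(b₁, …, bₙ) = ∑ᵢ f(b₁, …, bᵢ) g(bᵢ₊₁, …, bₙ)`, `0 ≤ i ≤ n`. -/
def cauchy (f g : List B → B) : List B → B := splitSum fun u v => f u * g v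

/-- All ways of cutting `p ++ l` (with `p` nonempty) into consecutive nonempty blocks,
the first of which begins with `p`. -/
def cutsFrom {X : Type*} : List X → List X → List (List (List X))
  | p, [] => [[p]]
  | p, x :: l => ((cutsFrom [x] l).map fun c => p :: c) ++ cutsFrom (p ++ [x]) l

/-- All ways of cutting a list into consecutive nonempty blocks. -/
def cuts {X : Type*} : List X → List (List (List X))
  | [] => [[]]
  | x :: l => cutsFrom [x] l

/-- The composition product:
`(f ∘ β)⁽ⁿ⁾ = ∑ f⁽ᵏ⁾ ∘ (β^(q₁) ⊗ ⋯ ⊗ β^(qₖ))` over `q₁ + ⋯ + qₖ = n`, `qᵢ ≥ 1`. The degree zero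
component of the result is that of `f`. -/
def comp {M : Type*} [AddCommMonoid M] (f : List B → M) (β : List B → B) (l : List B) : M :=
  ((cuts l).map fun c => f (c.map β)).sum

/-- The unit of the Cauchy product: the constant series `1`. -/
def oneSeries : List B → B
  | [] => 1
  | _ :: _ => 0

/-- The series `I = id_B`, concentrated in degree one. -/
def idSeries : List B → B
  | [b] => b
  | _ => 0

/-! ### Algebra of series -/

section splitSum

variable {X M N : Type*} [AddCommMonoid M] [AddCommMonoid N]

theorem splitSum_congr {H H' : List X → List X → M} {l : List X}
    (h : ∀ u v, u ++ v = l → H u v = H' u v) : splitSum H l = splitSum H' l := by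
  induction l generalizing H H' with
  | nil => exact h [] [] rfl
  | cons x l ih =>
    simp only [splitSum]
    rw [h [] (x :: l) rfl, ih (fun u v e => h (x :: u) v (by simp [e]))]

theorem splitSum_add (H H' : List X → List X → M) (l : List X) :
    splitSum (fun u v => H u v + H' u v) l = splitSum H l + splitSum H' l := by
  induction l generalizing H H' with
  | nil => rfl
  | cons x l ih => simp only [splitSum, ih]; abel

theorem map_splitSum (φ : M →+ N) (H : List X → List X → M) (l : List X) :
    φ (splitSum H l) = splitSum (fun u v => φ (H u v)) l := by
  induction l generalizing H with
  | nil => rfl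
  | cons x l ih => simp only [splitSum, map_add, ih]

theorem splitSum_zero (l : List X) : splitSum (fun _ _ => (0 : M)) l = 0 := by
  induction l with
  | nil => rfl
  | cons x l ih => simp only [splitSum, ih, add_zero]

theorem splitSum_assoc (H : List X → List X → List X → M) (l : List X) :
    splitSum (fun u v => splitSum (fun v₁ v₂ => H u v₁ v₂) v) l =
      splitSum (fun w v₂ => splitSum (fun u v₁ => H u v₁ v₂) w) l := by
  induction l generalizing H with
  | nil => rfl
  | cons x l ih => simp only [splitSum, splitSum_add, ih, add_assoc]

/-- Only the splitting with empty second piece contributes. -/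
theorem splitSum_right (H : List X → List X → M) (l : List X) (h : ∀ u x v, H u (x :: v) = 0) :
    splitSum H l = H l [] := by
  induction l generalizing H with
  | nil => rfl
  | cons x l ih => simp only [splitSum, h, zero_add]; exact ih _ (fun u y v => h _ _ _)

/-- Only the splitting with empty first piece contributes. -/
theorem splitSum_left (H : List X → List X → M) (l : List X) (h : ∀ x u v, H (x :: u) v = 0) :
    splitSum H l = H [] l := by
  cases l with
  | nil => rfl
  | cons x l => simp only [splitSum, h, splitSum_zero, add_zero]

end splitSum

theorem splitSum_additive {M : Type*} [AddCommMonoid M] (H : List B → List B → M)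
    (h₁ : ∀ l r v x y, H (l ++ (x + y) :: r) v = H (l ++ x :: r) v + H (l ++ y :: r) v)
    (h₂ : ∀ u l r x y, H u (l ++ (x + y) :: r) = H u (l ++ x :: r) + H u (l ++ y :: r))
    (l r : List B) (x y : B) :
    splitSum H (l ++ (x + y) :: r) = splitSum H (l ++ x :: r) + splitSum H (l ++ y :: r) := by
  induction l generalizing H with
  | nil =>
    have a := h₂ [] [] r x y
    have b := fun u v => h₁ [] u v x y
    simp only [List.nil_append] at a b
    simp only [List.nil_append, splitSum, a, b, splitSum_add]
    abel
  | cons z l ih =>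
    have a := h₂ [] (z :: l) r x y
    simp only [List.cons_append] at a
    simp only [List.cons_append, splitSum, a]
    rw [ih (fun u v => H (z :: u) v) (fun l r v x y => h₁ (z :: l) r v x y)
      (fun u => h₂ (z :: u))]
    abel

theorem splitSum_smul (c : ℂ) (H : List B → List B → B)
    (h₁ : ∀ l r v x, H (l ++ (c • x) :: r) v = c • H (l ++ x :: r) v)
    (h₂ : ∀ u l r x, H u (l ++ (c • x) :: r) = c • H u (l ++ x :: r))
    (l r : List B) (x : B) :
    splitSum H (l ++ (c • x) :: r) = c • splitSum H (l ++ x :: r) := by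
  induction l generalizing H with
  | nil =>
    have a := h₂ [] [] r x
    have b := fun u v => h₁ [] u v x
    simp only [List.nil_append] at a b
    simp only [List.nil_append, splitSum, a, b, smul_add]
    congr 1
    exact (map_splitSum (DistribSMul.toAddMonoidHom B c) _ _).symm
  | cons z l ih =>
    have a := h₂ [] (z :: l) r x
    simp only [List.cons_append] at a
    simp only [List.cons_append, splitSum, a, smul_add]
    rw [ih (fun u v => H (z :: u) v) (fun l r v x => h₁ (z :: l) r v x) (fun u => h₂ (z :: u))]

theorem cauchy_assoc (f g h : List B → B) :
    cauchy (cauchy f g) h = cauchy f (cauchy g h) := by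
  funext l
  have e₁ : ∀ u v, cauchy f g u * h v = splitSum (fun a b => f a * g b * h v) u := fun u v =>
    map_splitSum (AddMonoidHom.mulRight (h v)) _ _
  have e₂ : ∀ u v, f u * cauchy g h v = splitSum (fun a b => f u * (g a * h b)) v := fun u v =>
    map_splitSum (AddMonoidHom.mulLeft (f u)) _ _
  change splitSum (fun u v => cauchy f g u * h v) l = splitSum (fun u v => f u * cauchy g h v) l
  simp only [e₁, e₂, splitSum_assoc, mul_assoc]

theorem oneSeries_cauchy (f : List B → B) : cauchy oneSeries f = f := by
  funext l
  exact (splitSum_left _ l (by simp [oneSeries])).trans (by simp [oneSeries])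

theorem cauchy_oneSeries (f : List B → B) : cauchy f oneSeries = f := by
  funext l
  exact (splitSum_right _ l (by simp [oneSeries])).trans (by simp [oneSeries])

theorem IsMultilinear.oneSeries : IsMultilinear (oneSeries : List B → B) := by
  constructor
  · intro l; cases l <;> simp [CFree.oneSeries]
  · intro c l; cases l <;> simp [CFree.oneSeries]

theorem IsMultilinear.idSeries : IsMultilinear (idSeries : List B → B) := by
  constructor
  · intro l r; rcases l with _ | ⟨_, _ | _⟩ <;> cases r <;> simp [CFree.idSeries]
  · intro c l r; rcases l with _ | ⟨_, _ | _⟩ <;> cases r <;> simp [CFree.idSeries]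

theorem IsMultilinear.cauchy {f g : List B → B} (hf : IsMultilinear f) (hg : IsMultilinear g) :
    IsMultilinear (cauchy f g) := by
  constructor
  · intro l r x y
    exact splitSum_additive _ (fun l r v x y => by simp only [hf.1, add_mul])
      (fun u l r x y => by simp only [hg.1, mul_add]) l r x y
  · intro c l r x
    exact splitSum_smul c _ (fun l r v x => by simp only [hf.2, smul_mul_assoc])
      (fun u l r x => by simp only [hg.2, mul_smul_comm]) l r x

theorem IsMultilinear.cons {f : List B → B} (hf : IsMultilinear f) (b : B) :
    IsMultilinear (fun r => f (b :: r)) :=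
  ⟨fun l => hf.1 (b :: l), fun c l => hf.2 c (b :: l)⟩

theorem IsMultilinear.add {f g : List B → B} (hf : IsMultilinear f) (hg : IsMultilinear g) :
    IsMultilinear (f + g) :=
  ⟨fun l r x y => by simp only [Pi.add_apply, hf.1, hg.1]; abel,
    fun c l r x => by simp only [Pi.add_apply, hf.2, hg.2, smul_add]⟩

theorem IsMultilinear.sub {f g : List B → B} (hf : IsMultilinear f) (hg : IsMultilinear g) :
    IsMultilinear (f - g) :=
  ⟨fun l r x y => by simp only [Pi.sub_apply, hf.1, hg.1]; abel,
    fun c l r x => by simp only [Pi.sub_apply, hf.2, hg.2, smul_sub]⟩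

/-- The part of the composition product where the first block begins with `p`. -/
def compFrom {M : Type*} [AddCommMonoid M] (f : List B → M) (β : List B → B) (p l : List B) : M :=
  ((cutsFrom p l).map fun c => f (c.map β)).sum

section comp

variable {M N : Type*} [AddCommMonoid M] [AddCommMonoid N]

theorem comp_nil (f : List B → M) (β : List B → B) : comp f β [] = f [] := by
  simp [comp, cuts]

theorem compFrom_nil (f : List B → M) (β : List B → B) (p : List B) :
    compFrom f β p [] = f [β p] := by
  simp [compFrom, cutsFrom]

theorem compFrom_cons (f : List B → M) (β : List B → B) (p : List B) (x : B) (l : List B) :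
    compFrom f β p (x :: l) =
      compFrom (fun r => f (β p :: r)) β [x] l + compFrom f β (p ++ [x]) l := by
  simp [compFrom, cutsFrom, Function.comp_def]

theorem compFrom_eq (f : List B → M) (β : List B → B) (p l : List B) :
    compFrom f β p l = splitSum (fun u v => comp (fun r => f (β (p ++ u) :: r)) β v) l := by
  induction l generalizing f p with
  | nil => simp [compFrom_nil, splitSum, comp_nil]
  | cons x l ih =>
    rw [compFrom_cons, ih f]
    simp only [splitSum, List.append_nil, List.append_assoc, List.cons_append, List.nil_append]
    rfl

theorem comp_cons (f : List B → M) (β : List B → B) (x : B) (l : List B) :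
    comp f β (x :: l) = splitSum (fun u v => comp (fun r => f (β (x :: u) :: r)) β v) l :=
  compFrom_eq f β [x] l

theorem map_comp (φ : M →+ N) (f : List B → M) (β : List B → B) (l : List B) :
    φ (comp f β l) = comp (fun r => φ (f r)) β l := by
  simp [comp, map_list_sum, Function.comp_def]

theorem comp_add (f g : List B → M) (β : List B → B) (l : List B) :
    comp (fun r => f r + g r) β l = comp f β l + comp g β l := by
  simp [comp, List.sum_map_add]

theorem comp_zero (β : List B → B) (l : List B) : comp (fun _ => (0 : M)) β l = 0 := by
  simp [comp]

theorem comp_splitSum_comp (H : List B → List B → M) (γ : List B → B) (l : List B) :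
    comp (splitSum H) γ l =
      splitSum (fun l₁ l₂ => comp (fun r => comp (H r) γ l₂) γ l₁) l := by
  induction hn : l.length using Nat.strong_induction_on generalizing l H with
  | _ n ih =>
    cases l with
    | nil => simp [comp_nil, splitSum]
    | cons x t =>
      rw [comp_cons]
      simp only [splitSum, comp_add, splitSum_add, comp_nil]
      rw [← comp_cons (H [])]
      refine congrArg (comp (H []) γ (x :: t) + ·) ?_
      simp only [comp_cons]
      rw [← splitSum_assoc (fun u v₁ v₂ =>
        comp (fun r => comp (H (γ (x :: u) :: r)) γ v₂) γ v₁)]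
      refine splitSum_congr fun u v huv => ?_
      refine ih v.length ?_ _ v rfl
      subst hn huv
      simp only [List.length_cons, List.length_append]; omega

end comp

theorem comp_cauchy (f g β : List B → B) :
    comp (cauchy f g) β = cauchy (comp f β) (comp g β) := by
  funext l
  unfold cauchy
  rw [comp_splitSum_comp]
  refine splitSum_congr fun u v _ => ?_
  have e : ∀ r, comp (fun s => f r * g s) β v = f r * comp g β v := fun r =>
    (map_comp (AddMonoidHom.mulLeft (f r)) g β v).symm
  simp only [e]
  exact (map_comp (AddMonoidHom.mulRight (comp g β v)) f β u).symm

theorem comp_oneSeries (β : List B → B) : comp (oneSeries : List B → B) β = oneSeries := by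
  funext l
  cases l with
  | nil => simp [comp_nil]
  | cons x l => rw [comp_cons]; simp [oneSeries, comp_zero, splitSum_zero]

theorem idSeries_comp (β : List B → B) (hβ : β [] = 0) : comp idSeries β = β := by
  funext l
  cases l with
  | nil => simp [comp_nil, hβ, idSeries]
  | cons x l =>
    rw [comp_cons, splitSum_right]
    · simp [comp_nil, idSeries]
    · intro u y v
      rw [comp_cons]
      simp [idSeries, comp_zero, splitSum_zero]

/-- A function that is linear in each entry vanishes when one entry does. -/
theorem IsMultilinear.zero_cons {f : List B → B} (hf : IsMultilinear f) (r : List B) :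
    f (0 :: r) = 0 := by
  simpa using hf.2 0 [] r 0

theorem comp_idSeries (f : List B → B) (hf : IsMultilinear f) : comp f idSeries = f := by
  funext l
  induction l generalizing f with
  | nil => rw [comp_nil]
  | cons x l ih =>
    rw [comp_cons, splitSum_left]
    · exact ih _ (hf.cons x)
    · intro y u v
      simp [idSeries, hf.zero_cons, comp_zero]

theorem comp_assoc (f β γ : List B → B) (hf : IsMultilinear f) :
    comp (comp f β) γ = comp f (comp β γ) := by
  funext l
  induction hn : l.length using Nat.strong_induction_on generalizing l f with
  | _ n ih =>
    cases l with
    | nil => simp [comp_nil]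
    | cons x t =>
      rw [comp_cons, comp_cons]
      simp only [comp_cons f β]
      have e : ∀ u v, comp (fun r => splitSum (fun r₁ r₂ =>
          comp (fun s => f (β (γ (x :: u) :: r₁) :: s)) β r₂) r) γ v =
          splitSum (fun v₁ v₂ => comp (fun r₁ => comp (comp
            (fun s => f (β (γ (x :: u) :: r₁) :: s)) β) γ v₂) γ v₁) v := fun u v =>
        comp_splitSum_comp _ γ v
      simp only [e]
      rw [splitSum_assoc (fun u v₁ v₂ => comp (fun r₁ => comp (comp
            (fun s => f (β (γ (x :: u) :: r₁) :: s)) β) γ v₂) γ v₁)]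
      refine splitSum_congr fun w v hwv => ?_
      have hv : v.length < n := by
        subst hn hwv; simp only [List.length_cons, List.length_append]; omega
      have e' : ∀ b : B, comp (comp (fun s => f (b :: s)) β) γ v =
          comp (fun s => f (b :: s)) (comp β γ) v := fun b => ih _ hv _ (hf.cons b) v rfl
      simp only [e']
      let L : B →+ B := AddMonoidHom.mk' (fun b => comp (fun s => f (b :: s)) (comp β γ) v)
        (fun a b => by
          have := fun s => hf.1 [] s a b
          simp only [List.nil_append] at this
          simp only [this, comp_add])
      change splitSum (fun u v₁ => comp (fun r₁ => L (β (γ (x :: u) :: r₁))) γ v₁) w =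
        L (comp β γ (x :: w))
      rw [comp_cons, map_splitSum]
      exact splitSum_congr fun u v _ => (map_comp L _ γ v).symm

theorem compFrom_add {M : Type*} [AddCommMonoid M] (f g : List B → M) (β : List B → B)
    (p l : List B) :
    compFrom (fun r => f r + g r) β p l = compFrom f β p l + compFrom g β p l := by
  simp [compFrom, List.sum_map_add]

theorem compFrom_smul (c : ℂ) (f : List B → B) (β : List B → B) (p l : List B) :
    compFrom (fun r => c • f r) β p l = c • compFrom f β p l := by
  simp [compFrom, List.smul_sum, Function.comp_def]

theorem compFrom_multilinear (β : List B → B) (hβ : IsMultilinear β) (l : List B)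
    (f : List B → B) (hf : IsMultilinear f) :
    IsMultilinear (fun p => compFrom f β p l) := by
  induction l generalizing f with
  | nil =>
    simp only [compFrom_nil]
    constructor
    · intro l r x y
      simp only [hβ.1]; simpa using hf.1 [] [] _ _
    · intro c l r x
      simp only [hβ.2]; simpa using hf.2 c [] [] _
  | cons z t ih =>
    simp only [compFrom_cons]
    have h := ih f hf
    constructor
    · intro l r x y
      have a := h.1 l (r ++ [z]) x y
      have b := fun s => hf.1 [] s (β (l ++ x :: r)) (β (l ++ y :: r))
      simp only [List.nil_append] at b
      simp only [List.append_assoc, List.cons_append, a, hβ.1, b, compFrom_add]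
      abel
    · intro c l r x
      have a := h.2 c l (r ++ [z]) x
      have b := fun s => hf.2 c [] s (β (l ++ x :: r))
      simp only [List.nil_append] at b
      simp only [List.append_assoc, List.cons_append, a, hβ.2, b, compFrom_smul, smul_add]

theorem compFrom_multilinear' (β : List B → B) (hβ : IsMultilinear β) (p : List B)
    (f : List B → B) (hf : IsMultilinear f) :
    IsMultilinear (fun l => compFrom f β p l) := by
  constructor
  · intro l r x y
    induction l generalizing f p with
    | nil =>
      have a := (compFrom_multilinear β hβ r _ (hf.cons (β p))).1 [] [] x y
      have b := (compFrom_multilinear β hβ r f hf).1 p [] x y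
      simp only [List.nil_append] at a b ⊢
      simp only [compFrom_cons, a, b]
      abel
    | cons z l ih =>
      simp only [List.cons_append, compFrom_cons, ih _ _ hf, ih _ _ (hf.cons (β p))]
      abel
  · intro c l r x
    induction l generalizing f p with
    | nil =>
      have a := (compFrom_multilinear β hβ r _ (hf.cons (β p))).2 c [] [] x
      have b := (compFrom_multilinear β hβ r f hf).2 c p [] x
      simp only [List.nil_append] at a b ⊢
      simp only [compFrom_cons, a, b, smul_add]
    | cons z l ih =>
      simp only [List.cons_append, compFrom_cons, ih _ _ hf, ih _ _ (hf.cons (β p)), smul_add]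

theorem IsMultilinear.comp {f β : List B → B} (hf : IsMultilinear f) (hβ : IsMultilinear β) :
    IsMultilinear (comp f β) := by
  constructor
  · intro l r x y
    cases l with
    | nil => exact (compFrom_multilinear β hβ r f hf).1 [] [] x y
    | cons z l => exact (compFrom_multilinear' β hβ [z] f hf).1 l r x y
  · intro c l r x
    cases l with
    | nil => exact (compFrom_multilinear β hβ r f hf).2 c [] [] x
    | cons z l => exact (compFrom_multilinear' β hβ [z] f hf).2 c l r x

/-! ### Inverses, by iterating `g ↦ c + D g` for an operator `D` that raises degrees -/

/-- The `n`-th iterate, starting from `0`, of `g ↦ c + D g`. -/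
def iter (c : List B → B) (D : (List B → B) → List B → B) : ℕ → List B → B
  | 0 => 0
  | n + 1 => c + D (iter c D n)

/-- The solution of `g = c + D g`. -/
def fixSeries (c : List B → B) (D : (List B → B) → List B → B) : List B → B :=
  fun l => iter c D (l.length + 1) l

/-- `D g` depends in degree `n` on the components of `g` of degrees less than `n` only. -/
def Raises (D : (List B → B) → List B → B) : Prop :=
  ∀ (g h : List B → B) (l : List B),
    (∀ r : List B, r.length < l.length → g r = h r) → D g l = D h l

theorem iter_stable {c : List B → B} {D : (List B → B) → List B → B} (hD : Raises D) (n : ℕ)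
    (l : List B) (hl : l.length < n) : iter c D n l = fixSeries c D l := by
  have key : ∀ n (l : List B), l.length < n → iter c D (n + 1) l = iter c D n l := by
    intro n
    induction n with
    | zero => intro l hl; omega
    | succ n ih =>
      intro l hl
      change c l + D (iter c D (n + 1)) l = c l + D (iter c D n) l
      rw [hD _ _ l fun r hr => ih r (by omega)]
  obtain ⟨k, rfl⟩ : ∃ k, n = l.length + 1 + k := ⟨n - (l.length + 1), by omega⟩
  clear hl
  induction k with
  | zero => rfl
  | succ k ih => rw [← ih]; exact key (l.length + 1 + k) l (by omega)

theorem fixSeries_eq {c : List B → B} {D : (List B → B) → List B → B} (hD : Raises D) :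
    fixSeries c D = c + D (fixSeries c D) := by
  funext l
  change c l + D (iter c D l.length) l = c l + D (fixSeries c D) l
  rw [hD _ _ l fun r hr => iter_stable hD _ r hr]

theorem IsMultilinear.fixSeries {c : List B → B} {D : (List B → B) → List B → B}
    (hc : IsMultilinear c) (hD : ∀ g, IsMultilinear g → IsMultilinear (D g)) :
    IsMultilinear (fixSeries c D) := by
  have h : ∀ n, IsMultilinear (iter c D n) := by
    intro n
    induction n with
    | zero => exact ⟨fun _ _ _ _ => by simp [iter], fun _ _ _ _ => by simp [iter]⟩
    | succ n ih => exact hc.add (hD _ ih)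
  constructor
  · intro l r x y
    simpa [CFree.fixSeries] using (h _).1 l r x y
  · intro c' l r x
    simpa [CFree.fixSeries] using (h _).2 c' l r x

theorem raises_cauchy (f : List B → B) (hf : f [] = 0) : Raises fun g => cauchy g f := by
  intro g h l hl
  refine splitSum_congr fun u v huv => ?_
  cases v with
  | nil => simp [hf]
  | cons x v => rw [hl u (by subst huv; simp)]

theorem comp_congr {f g : List B → B} (β : List B → B) {l : List B}
    (h : ∀ r : List B, r.length ≤ l.length → f r = g r) : comp f β l = comp g β l := by
  induction hn : l.length using Nat.strong_induction_on generalizing l f g with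
  | _ n ih =>
    cases l with
    | nil => rw [comp_nil, comp_nil]; exact h _ le_rfl
    | cons x t =>
      rw [comp_cons, comp_cons]
      refine splitSum_congr fun u v huv => ?_
      subst huv
      refine ih v.length (by subst hn; simp only [List.length_cons, List.length_append]; omega) (fun r hr => h _ ?_) rfl
      simp; omega

theorem comp_top {f α : List B → B} (hα : ∀ b, α [b] = b) {l : List B}
    (h : ∀ r : List B, r.length < l.length → f r = 0) : comp f α l = f l := by
  induction l generalizing f with
  | nil => rw [comp_nil]
  | cons x t ih =>
    rw [comp_cons, splitSum_congr (H' := fun u v => if u = [] then f (x :: v) else 0),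
      splitSum_left]
    · simp
    · simp
    · intro u v huv
      subst huv
      cases u with
      | nil =>
        rw [hα, if_pos rfl]
        exact ih fun r hr => h _ (by simpa using hr)
      | cons y u =>
        rw [if_neg (by simp), comp_congr (g := fun _ => 0), comp_zero]
        intro r hr
        exact h _ (by simp; omega)

theorem comp_sub (f g β : List B → B) : comp (f - g) β = comp f β - comp g β := by
  funext l
  have := comp_add (f - g) g β l
  simp only [Pi.sub_apply, sub_add_cancel] at this
  simp only [Pi.sub_apply]
  rw [eq_sub_iff_add_eq]
  exact this.symm

theorem raises_comp (α : List B → B) (hα : ∀ b, α [b] = b) : Raises fun g => g - comp g α := by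
  intro g h l hl
  have := comp_top (f := g - h) hα (l := l) fun r hr => by simp [hl r hr]
  rw [comp_sub] at this
  simp only [Pi.sub_apply] at this ⊢
  rw [sub_eq_sub_iff_sub_eq_sub, this]

variable (B) in
/-- Multilinear function series over `B` with constant term `1`. -/
@[ext]
structure UnitalSeries where
  toFun : List B → B
  multilinear : IsMultilinear toFun
  map_nil : toFun [] = 1

variable (B) in
/-- Multilinear function series over `B` with zero constant term and degree one term `id_B`. -/
@[ext]
structure CompSeries where
  toFun : List B → B
  multilinear : IsMultilinear toFun
  map_nil : toFun [] = 0
  map_singleton : ∀ b, toFun [b] = b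

namespace UnitalSeries

instance : Mul (UnitalSeries B) :=
  ⟨fun f g => ⟨cauchy f.toFun g.toFun, f.multilinear.cauchy g.multilinear,
    by simp [cauchy, splitSum, f.map_nil, g.map_nil]⟩⟩

instance : One (UnitalSeries B) := ⟨⟨oneSeries, .oneSeries, rfl⟩⟩

instance : Inv (UnitalSeries B) :=
  ⟨fun f => ⟨fixSeries oneSeries fun g => cauchy g (oneSeries - f.toFun),
    .fixSeries .oneSeries fun _ hg => hg.cauchy (.sub .oneSeries f.multilinear),
    by simp [fixSeries, iter, cauchy, splitSum, oneSeries]⟩⟩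

theorem mul_toFun (f g : UnitalSeries B) : (f * g).toFun = cauchy f.toFun g.toFun := rfl

theorem one_toFun : (1 : UnitalSeries B).toFun = oneSeries := rfl

theorem cauchy_sub (f g h : List B → B) : cauchy f (g - h) = cauchy f g - cauchy f h := by
  funext l
  have := splitSum_add (fun u v => f u * (g - h) v) (fun u v => f u * h v) l
  simp only [Pi.sub_apply, ← mul_add, sub_add_cancel] at this
  simp only [Pi.sub_apply]
  rw [eq_sub_iff_add_eq]
  exact this.symm

theorem inv_mul_toFun (f : UnitalSeries B) : (f⁻¹ * f).toFun = oneSeries := by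
  have h := fixSeries_eq (c := oneSeries)
    (raises_cauchy (oneSeries - f.toFun) (by simp [oneSeries, f.map_nil]))
  change cauchy (fixSeries oneSeries fun g => cauchy g (oneSeries - f.toFun)) f.toFun = oneSeries
  simp only [cauchy_sub, cauchy_oneSeries] at h ⊢
  rw [add_sub, add_comm, eq_sub_iff_add_eq] at h
  exact add_left_cancel h

/-- The group of series with constant term `1` under the Cauchy product. -/
instance : Group (UnitalSeries B) :=
  Group.ofLeftAxioms
    (fun f g h => UnitalSeries.ext (cauchy_assoc f.toFun g.toFun h.toFun))
    (fun f => UnitalSeries.ext (oneSeries_cauchy f.toFun))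
    (fun f => UnitalSeries.ext (inv_mul_toFun f))

end UnitalSeries

namespace CompSeries

instance : Mul (CompSeries B) :=
  ⟨fun α β => ⟨comp α.toFun β.toFun, α.multilinear.comp β.multilinear,
    by rw [comp_nil, α.map_nil],
    fun b => by rw [comp_cons, splitSum, comp_nil, β.map_singleton, α.map_singleton]⟩⟩

instance : One (CompSeries B) := ⟨⟨idSeries, .idSeries, rfl, fun _ => rfl⟩⟩

theorem comp_fix (α : CompSeries B) :
    comp (fixSeries idSeries fun g => g - comp g α.toFun) α.toFun = idSeries := by
  have h := fixSeries_eq (c := idSeries) (raises_comp α.toFun α.map_singleton)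
  rw [add_sub, add_comm, eq_sub_iff_add_eq] at h
  exact add_left_cancel h

instance : Inv (CompSeries B) :=
  ⟨fun α => ⟨fixSeries idSeries fun g => g - comp g α.toFun,
    .fixSeries .idSeries fun _ hg => hg.sub (hg.comp α.multilinear),
    by simp [fixSeries, iter, comp_nil, idSeries],
    fun b => by
      have h := congrFun (comp_fix α) [b]
      rwa [comp_cons, splitSum, comp_nil, α.map_singleton] at h⟩⟩

theorem mul_toFun (α β : CompSeries B) : (α * β).toFun = comp α.toFun β.toFun := rfl

theorem one_toFun : (1 : CompSeries B).toFun = idSeries := rfl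

/-- The group of series starting with `id_B` under the composition product. -/
instance : Group (CompSeries B) :=
  Group.ofLeftAxioms
    (fun α β γ => CompSeries.ext (comp_assoc α.toFun β.toFun γ.toFun α.multilinear))
    (fun α => CompSeries.ext (idSeries_comp α.toFun α.map_nil))
    (fun α => CompSeries.ext (comp_fix α))

end CompSeries

/-- The right action `(1 + f) · α = 1 + f ∘ α` by group automorphisms. -/
instance : MulDistribMulAction (CompSeries B)ᵐᵒᵖ (UnitalSeries B) where
  smul α f := ⟨comp f.toFun α.unop.toFun, f.multilinear.comp α.unop.multilinear,
    by rw [comp_nil, f.map_nil]⟩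
  one_smul f := UnitalSeries.ext (comp_idSeries f.toFun f.multilinear)
  mul_smul α β f := UnitalSeries.ext
    (comp_assoc f.toFun β.unop.toFun α.unop.toFun f.multilinear).symm
  smul_mul α f g := UnitalSeries.ext (comp_cauchy f.toFun g.toFun α.unop.toFun)
  smul_one α := UnitalSeries.ext (comp_oneSeries α.unop.toFun)

theorem act_toFun (f : UnitalSeries B) (α : CompSeries B) :
    (f <• α).toFun = comp f.toFun α.toFun := rfl

/-! ### The translations by `I` -/

/-- The left translation `A ↦ I.A`. -/
def leftTranslation (A : UnitalSeries B) : CompSeries B where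
  toFun := cauchy idSeries A.toFun
  multilinear := .cauchy .idSeries A.multilinear
  map_nil := by simp [cauchy, splitSum, idSeries]
  map_singleton b := by simp [cauchy, splitSum, idSeries, A.map_nil]

/-- The right translation `A ↦ A.I`. -/
def rightTranslation (A : UnitalSeries B) : CompSeries B where
  toFun := cauchy A.toFun idSeries
  multilinear := .cauchy A.multilinear .idSeries
  map_nil := by simp [cauchy, splitSum, idSeries]
  map_singleton b := by simp [cauchy, splitSum, idSeries, A.map_nil]

/-- `λ : A ↦ I.A` as an `O`-group operator on the opposite of the group of unital series. -/
def lam : OGroupOperator (UnitalSeries B)ᵐᵒᵖ (CompSeries B) where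
  toFun A := leftTranslation A.unop
  map_star A A' := by
    apply CompSeries.ext
    change comp (cauchy idSeries A.unop.toFun) (leftTranslation A'.unop).toFun =
      cauchy idSeries (cauchy A'.unop.toFun (comp A.unop.toFun (leftTranslation A'.unop).toFun))
    rw [comp_cauchy, idSeries_comp _ (leftTranslation A'.unop).map_nil, ← cauchy_assoc]
    rfl

/-- `ρ : A ↦ A.I` as an `O`-group operator. -/
def rho : OGroupOperator (UnitalSeries B) (CompSeries B) where
  toFun := rightTranslation
  map_star A A' := by
    apply CompSeries.ext
    change comp (cauchy A.toFun idSeries) (rightTranslation A').toFun =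
      cauchy (cauchy (comp A.toFun (rightTranslation A').toFun) A'.toFun) idSeries
    rw [comp_cauchy, idSeries_comp _ (rightTranslation A').map_nil, cauchy_assoc]
    rfl

/-- `(λ^{-1#} # ρ)(A) = A.I.A⁻¹`. -/
theorem sharp_lam_rho_toFun (A : UnitalSeries B) :
    (sharp (lam (B := B)).sharpInv rho A).toFun =
      cauchy (cauchy A.toFun idSeries) (A⁻¹).toFun := by
  have e : (sharp (lam (B := B)).sharpInv rho A).toFun =
      comp (cauchy idSeries ((A <• (rightTranslation A)⁻¹)⁻¹).toFun)
        (rightTranslation A).toFun := rfl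
  have e' : (A <• (rightTranslation A)⁻¹)⁻¹ <• rightTranslation A = A⁻¹ := by
    simp [smul_inv', smul_smul]
  rw [e, comp_cauchy, idSeries_comp _ (rightTranslation A).map_nil, ← act_toFun, e']
  rfl

/-- `λ^{-1#} # ρ` as an `O`-group operator. -/
def lamInvSharpRho : OGroupOperator (UnitalSeries B) (CompSeries B) where
  toFun := sharp (lam (B := B)).sharpInv rho
  map_star A A' := by
    apply CompSeries.ext
    set α := sharp (lam (B := B)).sharpInv rho A' with hα
    have hα' := sharp_lam_rho_toFun A'
    rw [← hα] at hα'
    rw [CompSeries.mul_toFun, sharp_lam_rho_toFun, comp_cauchy, comp_cauchy,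
      idSeries_comp _ α.map_nil, ← act_toFun, ← act_toFun, hα', sharp_lam_rho_toFun, mul_inv_rev,
      ← smul_inv']
    simp only [UnitalSeries.mul_toFun, cauchy_assoc]

end Series

/-! ## Conditional operator-valued probability spaces -/

/-- A conditional operator-valued probability space `(A, φ, ψ, B)`: a unital complex algebra `A`
over the unital complex algebra `B` (acting on both sides through `ι`), with two unital
`B`-bimodule maps `φ, ψ : A → B`. -/
structure CondProbSpace (A B : Type*) [Ring A] [Algebra ℂ A] [Ring B] [Algebra ℂ B] where
  ι : B →ₐ[ℂ] A
  φ : A →ₗ[ℂ] B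
  ψ : A →ₗ[ℂ] B
  φ_one : φ 1 = 1
  ψ_one : ψ 1 = 1
  φ_bimodule : ∀ (b b' : B) (x : A), φ (ι b * x * ι b') = b * φ x * b'
  ψ_bimodule : ∀ (b b' : B) (x : A), ψ (ι b * x * ι b') = b * ψ x * b'

namespace CondProbSpace

variable {A B : Type*} [Ring A] [Algebra ℂ A] [Ring B] [Algebra ℂ B] (S : CondProbSpace A B)

/-- The subalgebra generated by `B` and `x`. -/
def generated (x : A) : Subalgebra ℂ A := Algebra.adjoin ℂ (Set.range S.ι ∪ {x})

/-- `w = [(i₁, p₁), …, (iₙ, pₙ)]` is an alternating word of `ψ`-centred elements: `n ≥ 1`,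
`i₁ ≠ i₂ ≠ ⋯ ≠ iₙ`, and `pⱼ` lies in the algebra generated by `B` and `a` (if `iⱼ = true`), resp.
by `B` and `b` (if `iⱼ = false`), with `ψ(pⱼ) = 0`. -/
def IsAlternatingCentred (a b : A) (w : List (Bool × A)) : Prop :=
  w ≠ [] ∧ w.IsChain (fun q q' => q.1 ≠ q'.1) ∧
    ∀ q ∈ w, q.2 ∈ S.generated (if q.1 = true then a else b) ∧ S.ψ q.2 = 0

/-- `a` and `b` are conditionally free: they are free with respect to `ψ`, and
`φ(p₁ ⋯ pₙ) = φ(p₁) ⋯ φ(pₙ)` for alternating `ψ`-centred words. -/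
def CondFree (a b : A) : Prop :=
  (∀ w, S.IsAlternatingCentred a b w → S.ψ (w.map Prod.snd).prod = 0) ∧
  ∀ w, S.IsAlternatingCentred a b w →
    S.φ (w.map Prod.snd).prod = (w.map fun q => S.φ q.2).prod

/-! ### Cumulants

The moment-cumulant relations, sorted by the block `V = {1 = v₁ < ⋯ < vₖ}` of the first entry, read
`φ(a₁ ⋯ aₙ) = ∑_V κᶜₖ(a_{v₁} ψ(w₁), …, a_{vₖ₋₁} ψ(wₖ₋₁), a_{vₖ}) φ(wₖ)`,
where `wⱼ` is the product of the entries strictly between `vⱼ` and `vⱼ₊₁`, and `wₖ` that of the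
entries after `vₖ`. The free cumulants obey the same relations with `φ` replaced by `ψ`. Iterating
gives the sum over noncrossing partitions with `κᶜ` on the outer and `κ` on the inner blocks. -/

/-- `firstBlocks a w l` enumerates the pairs
`([a_{v₁} ψ(w₁), …, a_{vₖ₋₁} ψ(wₖ₋₁), a_{vₖ}], entries after vₖ)` for the words starting with `a`
followed by `w ++ l`, over those `V` containing the position of `a` and no position in `w`. -/
def firstBlocks : A → List A → List A → List (List A × List A)
  | a, w, [] => [([a], w)]
  | a, w, x :: l => firstBlocks a (w ++ [x]) l ++
      (firstBlocks x [] l).map fun q => (a * S.ι (S.ψ w.prod) :: q.1, q.2)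

/-- The cumulants determined by the moment-cumulant relations for the moments of `E` (outer blocks)
and `ψ` (inner blocks). The term in which `V` is the whole word is isolated on the left. -/
def cumulant (E : A →ₗ[ℂ] B) : List A → B
  | [] => 0
  | a :: l => E (a :: l).prod - ((S.firstBlocks a [] l).map fun q =>
      if _h : q.1.length < (a :: l).length then cumulant E q.1 * E q.2.prod else 0).sum
termination_by l => l.length
decreasing_by exact _h

/-- Free cumulants `κₙ` (with respect to `ψ`). -/
def freeCumulant : List A → B := S.cumulant S.ψ

/-- Conditionally free cumulants `κᶜₙ`. -/
def condFreeCumulant : List A → B := S.cumulant S.φ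

/-- The list `[x b₁, x b₂, …, x bₙ, x]`. -/
def cumulantArgs (x : A) (bs : List B) : List A := (bs.map fun b => x * S.ι b) ++ [x]

/-- The free cumulant series `K_x⁽ⁿ⁾(b₁, …, bₙ) = κₙ₊₁(x b₁, …, x bₙ, x)`. -/
def K (x : A) (bs : List B) : B := S.freeCumulant (S.cumulantArgs x bs)

/-- The conditionally free cumulant series
`K_xᶜ⁽ⁿ⁾(b₁, …, bₙ) = κᶜₙ₊₁(x b₁, …, x bₙ, x)`. -/
def Kc (x : A) (bs : List B) : B := S.condFreeCumulant (S.cumulantArgs x bs)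

/-- `(T, Tᶜ)` is a conditional `T`-transform of `x`: `(K_x, K_xᶜ) = e_{λ|ε}(T, Tᶜ)`. Since `λ` is an
`O`-group operator on the opposite group, so is the relative transform. -/
def IsCondTTransform (x : A) (t : UnitalSeries B × UnitalSeries B) : Prop :=
  let e := relativeTransform lam (MulOpposite.op t.1, MulOpposite.op t.2)
  e.base.unop.toFun = S.K x ∧ e.fiber.unop.toFun = S.Kc x

end CondProbSpace

end CFree

namespace CFree

set_option linter.unusedSectionVars false

/-! ### The ring of series with coefficients in a ring -/

/-! All series live in noncommutative rings `Ser B A` under the Cauchy product, where `S.resolvent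
x` is `(1 - x.I)⁻¹` and `momentSeries` is its image under `E`, with `E` standing for `φ` or `ψ`.
Write `M` for this image, `N` for the one under `ψ`, `K` for the cumulant series of `E`. Sorting the
moment-cumulant relations by the first block gives `M = 1 + (K ∘ (I.N)).I.M` (`momentSeries_eq`).

Unfolded, `(K_x, K_xᶜ) = e(T, Tᶜ)` says that `K_x` and `K_xᶜ`, composed with `I.T⁻¹`, become `T` and
`Tᶜ` (`isCondTTransform_iff`). The substitution `U = I.(1 + I)⁻¹.T⁻¹` turns `I.N` into `I.T⁻¹`, so
the functional equation becomes `E((1 - x.U)⁻¹) = (1 - T'.U)⁻¹`, where `T'` is `T` for `ψ` and `Tᶜ`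
for `φ` (`compHom_momentSeries`). Conversely these equations force `T` and `T'` to be the transform
(`compHom_cumulantSeries`).

For a product put `σ = T_b.I.T_b⁻¹`, `t = T_a ∘ σ`, `p = T_a' ∘ σ`, `q = T_b'`. The substitution
belonging to `t.T_b` is `v.t⁻¹`, where `v` is that of `T_b`, and that of `T_a` becomes `u =
T_b.v.t⁻¹` after composition with `σ`. It remains to derive `E((1 - a.b.v.t⁻¹)⁻¹) = (1 -
p.q.v.t⁻¹)⁻¹` from the equations for `X = (1 - a.u)⁻¹` and `Y = (1 - b.v)⁻¹` (`map_resolvent_mul`).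
With `s = ψ(Y)` one has `ψ(X.a) = t.s`, and `resolvent_factorization` gives `X.(1 - a.b.v.t⁻¹).t.Y =
t.s - (X.a - t.s).s⁻¹.(Y - s)`. The two factors on the right are `ψ`-centred, so inverting yields a
geometric series of alternating words, on which `E` is multiplicative. The same algebraic identity
holds for the `B`-valued series `E(X)`, `p`, `q`, `E(Y)`, and resumming with it gives the claim. -/

/-- Series `List B → A` with the Cauchy product. -/
def Ser (B A : Type*) := List B → A

theorem splitSum_concat {X M : Type*} [AddCommMonoid M] (H : List X → List X → M) (l : List X)
    (x : X) : splitSum H (l ++ [x]) = splitSum (fun u v => H u (v ++ [x])) l + H (l ++ [x]) [] := by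
  induction l generalizing H with
  | nil => rfl
  | cons y l ih => simp only [List.cons_append, splitSum, ih, add_assoc]

theorem splitSum_mem {X M : Type*} [AddCommMonoid M] (P : AddSubmonoid M) (H : List X → List X → M)
    (l : List X) (h : ∀ u v, H u v ∈ P) : splitSum H l ∈ P := by
  induction l generalizing H with
  | nil => exact h _ _
  | cons x l ih => exact P.add_mem (h _ _) (ih _ fun u v => h _ _)

namespace Ser

variable {B A A' : Type*} [Ring A] [Ring A']

@[ext]
theorem ext {f g : Ser B A} (h : ∀ l, f l = g l) : f = g := funext h

instance : AddCommGroup (Ser B A) := inferInstanceAs (AddCommGroup (List B → A))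

instance : Mul (Ser B A) := ⟨fun f g => splitSum fun u v => f u * g v⟩

/-- Constant series. -/
def const (x : A) : Ser B A
  | [] => x
  | _ :: _ => 0

instance : One (Ser B A) := ⟨const 1⟩

@[simp] theorem add_apply (f g : Ser B A) (l : List B) : (f + g) l = f l + g l := rfl
@[simp] theorem sub_apply (f g : Ser B A) (l : List B) : (f - g) l = f l - g l := rfl
@[simp] theorem zero_apply (l : List B) : (0 : Ser B A) l = 0 := rfl
@[simp] theorem const_nil (x : A) : (const x : Ser B A) [] = x := rfl
@[simp] theorem const_cons (x : A) (b : B) (l : List B) : (const x : Ser B A) (b :: l) = 0 := rfl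
@[simp] theorem one_nil : (1 : Ser B A) [] = 1 := rfl
@[simp] theorem one_cons (b : B) (l : List B) : (1 : Ser B A) (b :: l) = 0 := rfl

theorem mul_apply (f g : Ser B A) (l : List B) :
    (f * g) l = splitSum (fun u v => f u * g v) l := rfl

@[simp] theorem mul_nil (f g : Ser B A) : (f * g) [] = f [] * g [] := rfl

theorem const_mul_apply (x : A) (f : Ser B A) (l : List B) : ((const x : Ser B A) * f) l = x * f l :=
  (splitSum_left _ l (by simp)).trans (by simp)

theorem mul_const_apply (x : A) (f : Ser B A) (l : List B) : (f * (const x : Ser B A)) l = f l * x :=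
  (splitSum_right _ l (by simp)).trans (by simp)

instance : Ring (Ser B A) where
  __ := (inferInstance : AddCommGroup (Ser B A))
  left_distrib f g h := by
    ext l; simp only [add_apply, mul_apply, mul_add, splitSum_add]
  right_distrib f g h := by
    ext l; simp only [add_apply, mul_apply, add_mul, splitSum_add]
  zero_mul f := by ext l; simp only [zero_apply, mul_apply, zero_mul, splitSum_zero]
  mul_zero f := by ext l; simp only [zero_apply, mul_apply, mul_zero, splitSum_zero]
  mul_assoc f g h := by
    ext l
    have e₁ : ∀ u v, (f * g) u * h v = splitSum (fun a b => f a * g b * h v) u := fun u v =>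
      map_splitSum (AddMonoidHom.mulRight (h v)) _ _
    have e₂ : ∀ u v, f u * (g * h) v = splitSum (fun a b => f u * (g a * h b)) v := fun u v =>
      map_splitSum (AddMonoidHom.mulLeft (f u)) _ _
    simp only [mul_apply (f * g), mul_apply f (g * h), e₁, e₂, splitSum_assoc, mul_assoc]
  one_mul f := by ext l; exact (const_mul_apply 1 f l).trans (one_mul _)
  mul_one f := by ext l; exact (mul_const_apply 1 f l).trans (mul_one _)

theorem const_mul_const (x y : A) : (const x * const y : Ser B A) = const (x * y) := by
  ext l
  rw [const_mul_apply]
  cases l <;> simp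

/-- Coefficientwise application of an additive map. -/
def map (E : A →+ A') : Ser B A →+ Ser B A' where
  toFun f l := E (f l)
  map_zero' := by ext l; exact map_zero E
  map_add' f g := by ext l; exact map_add E _ _

@[simp] theorem map_apply (E : A →+ A') (f : Ser B A) (l : List B) : map E f l = E (f l) := rfl

/-- Coefficientwise application of a ring homomorphism. -/
def mapRing (j : A →+* A') : Ser B A →+* Ser B A' where
  toFun f l := j (f l)
  map_zero' := by ext l; exact map_zero j
  map_add' f g := by ext l; exact map_add j _ _
  map_one' := by
    ext l
    cases l with
    | nil => exact map_one j
    | cons b l => exact map_zero j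
  map_mul' f g := by
    ext l
    refine (map_splitSum (j : A →+ A') _ l).trans ?_
    exact splitSum_congr fun u v _ => map_mul j (f u) (g v)

@[simp] theorem mapRing_apply (j : A →+* A') (f : Ser B A) (l : List B) :
    mapRing j f l = j (f l) := rfl

/-- A coefficientwise bimodule map is a bimodule map for the series. -/
theorem map_bimodule (j : A' →+* A) (E : A →+ A')
    (hE : ∀ b b' x, E (j b * x * j b') = b * E x * b') (f g : Ser B A') (X : Ser B A) :
    map E (mapRing j f * X * mapRing j g) = f * map E X * g := by
  ext l
  simp only [mul_apply, map_apply]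
  rw [map_splitSum]
  refine splitSum_congr fun u v _ => ?_
  simp only [mapRing_apply]
  have e₁ : splitSum (fun u v => j (f u) * X v) u * j (g v) =
      splitSum (fun a b => j (f a) * X b * j (g v)) u :=
    map_splitSum (AddMonoidHom.mulRight (j (g v))) _ _
  have e₂ : splitSum (fun u v => f u * E (X v)) u * g v =
      splitSum (fun a b => f a * E (X b) * g v) u :=
    map_splitSum (AddMonoidHom.mulRight (g v)) _ _
  rw [e₁, e₂, map_splitSum]
  exact splitSum_congr fun _ _ _ => hE _ _ _

/-! ### Order of vanishing and geometric series -/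

/-- The series vanishing on the lists of length less than `n`. -/
def Vanishes (n : ℕ) (f : Ser B A) : Prop := ∀ l : List B, l.length < n → f l = 0

theorem Vanishes.mul {m n : ℕ} {f g : Ser B A} (hf : Vanishes m f) (hg : Vanishes n g) :
    Vanishes (m + n) (f * g) := by
  intro l hl
  rw [mul_apply, splitSum_congr (H' := fun _ _ => 0), splitSum_zero]
  intro u v huv
  have h : u.length + v.length = l.length := by rw [← huv, List.length_append]
  by_cases hu : u.length < m
  · rw [hf u hu, zero_mul]
  · rw [hg v (by omega), mul_zero]

theorem Vanishes.zero (f : Ser B A) : Vanishes 0 f := fun _ h => absurd h (by simp)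

theorem Vanishes.mul_left {n : ℕ} {g : Ser B A} (f : Ser B A) (hg : Vanishes n g) :
    Vanishes n (f * g) := by
  simpa using (Vanishes.zero f).mul hg

theorem Vanishes.mul_right {n : ℕ} {f : Ser B A} (hf : Vanishes n f) (g : Ser B A) :
    Vanishes n (f * g) := by
  simpa using hf.mul (Vanishes.zero g)

theorem Vanishes.pow {f : Ser B A} (hf : f [] = 0) (n : ℕ) : Vanishes n (f ^ n) := by
  induction n with
  | zero => exact Vanishes.zero _
  | succ n ih =>
    rw [pow_succ]
    refine ih.mul fun l hl => ?_
    rw [List.length_eq_zero_iff.1 (by omega : l.length = 0), hf]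

theorem eq_of_vanishes {f g : Ser B A} (h : ∀ n, Vanishes n (f - g)) : f = g := by
  ext l
  exact sub_eq_zero.1 (h (l.length + 1) l (Nat.lt_succ_self _))

/-- If `y` has no constant term, a right inverse of `1 - y` is a left inverse. -/
theorem inv_comm {y R : Ser B A} (hy : y [] = 0) (h : R = 1 + y * R) : R = 1 + R * y := by
  have hZ : R - (1 + R * y) = y * (R - (1 + R * y)) := by
    calc R - (1 + R * y) = (1 + y * R) - (1 + (1 + y * R) * y) := by rw [← h]
      _ = _ := by noncomm_ring
  have hn : ∀ n, R - (1 + R * y) = y ^ n * (R - (1 + R * y)) := by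
    intro n
    induction n with
    | zero => simp
    | succ n ih => rw [pow_succ, mul_assoc, ← hZ]; exact ih
  refine eq_of_vanishes fun n => ?_
  rw [hn n]
  exact (Vanishes.pow hy n).mul_right _

/-- The truncated geometric series. -/
theorem eq_geom_add {γ X Y : Ser B A} (h : (1 - γ) * X = Y) (n : ℕ) :
    X = (∑ i ∈ Finset.range n, γ ^ i * Y) + γ ^ n * X := by
  induction n with
  | zero => simp
  | succ n ih =>
    rw [Finset.sum_range_succ, ← h, pow_succ, add_assoc]
    rw [← h] at ih
    calc X = _ := ih
      _ = _ := by noncomm_ring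

/-! #### Composition -/

section comp

variable {B : Type*} [Ring B] [Algebra ℂ B]

theorem comp_const (β : Ser B B) (x : A) : comp (const x : Ser B A) β = (const x : Ser B A) := by
  ext l
  cases l with
  | nil => exact comp_nil _ _
  | cons b l =>
    refine (comp_cons _ _ _ _).trans ?_
    exact (splitSum_congr fun u v _ => comp_zero β v).trans (splitSum_zero l)

/-- Composition with `β` on the right, as a ring homomorphism. -/
def compHom (β : Ser B B) : Ser B A →+* Ser B A where
  toFun f l := comp f β l
  map_zero' := by ext l; exact comp_zero β l
  map_add' f g := by ext l; exact comp_add f g β l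
  map_one' := comp_const β 1
  map_mul' f g := by
    ext l
    refine (comp_splitSum_comp (fun u v => f u * g v) β l).trans ?_
    refine splitSum_congr fun u v _ => ?_
    have e : ∀ r, comp (fun s => f r * g s) β v = f r * comp g β v := fun r =>
      (map_comp (AddMonoidHom.mulLeft (f r)) g β v).symm
    simp only [e]
    exact (map_comp (AddMonoidHom.mulRight (comp g β v)) f β u).symm

theorem compHom_nil (β : Ser B B) (f : Ser B A) : compHom β f [] = f [] := comp_nil _ _

theorem compHom_const (β : Ser B B) (x : A) : compHom β (const x : Ser B A) = const x :=
  comp_const β x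

theorem map_compHom (E : A →+ A') (β : Ser B B) (f : Ser B A) :
    map E (compHom β f) = compHom β (map E f) := by
  ext l
  exact map_comp E f β l

theorem mapRing_compHom (j : A →+* A') (β : Ser B B) (f : Ser B A) :
    mapRing j (compHom β f) = compHom β (mapRing j f) := map_compHom (j : A →+ A') β f

variable (B) in
/-- The identity series. -/
def I : Ser B B := idSeries

theorem I_nil : I B [] = 0 := rfl

theorem compHom_I {β : Ser B B} (hβ : β [] = 0) : compHom β (I B) = β := idSeries_comp β hβ

theorem compHom_compHom {f : Ser B B} (hf : IsMultilinear f) (β γ : Ser B B) :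
    compHom γ (compHom β f) = compHom (compHom γ β) f := comp_assoc f β γ hf

theorem compHom_by_I {f : Ser B B} (hf : IsMultilinear f) : compHom (I B) f = f :=
  comp_idSeries f hf

/-- Composition with a series whose linear term is the identity is unitriangular with respect to
degree. -/
theorem compHom_injective {β : Ser B B} (hβ : ∀ b, β [b] = b) :
    Function.Injective (compHom β : Ser B B → Ser B B) := by
  intro f g h
  have h0 : compHom β (f - g) = 0 := by rw [map_sub, h, sub_self]
  refine sub_eq_zero.1 (Ser.ext fun l => ?_)
  induction hn : l.length using Nat.strong_induction_on generalizing l with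
  | _ n ih =>
    have := comp_top (f := f - g) hβ (l := l) fun r hr => ih r.length (hn ▸ hr) r rfl
    rw [← this]
    exact congrFun h0 l

theorem mapRing_I_mul_cons (j : B →+* A) (f : Ser B A) (b : B) (l : List B) :
    (mapRing j (I B) * f) (b :: l) = j b * f l := by
  simp only [mul_apply, splitSum, mapRing_apply]
  rw [splitSum_left _ l (fun x u v => by simp [I, idSeries])]
  simp [I, idSeries]

theorem I_mul_cons (f : Ser B B) (b : B) (l : List B) : (I B * f) (b :: l) = b * f l :=
  mapRing_I_mul_cons (RingHom.id B) f b l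

theorem mul_I_concat (f : Ser B B) (b : B) (l : List B) : (f * I B) (l ++ [b]) = f l * b := by
  rw [mul_apply, splitSum_concat, splitSum_right]
  · simp [I, idSeries]
  · intro u x v
    cases v <;> simp [I, idSeries]

/-- Setting the last argument to `1` recovers `f` from `f.I`. -/
theorem mul_I_cancel {f g : Ser B B} (h : f * I B = g * I B) : f = g := by
  ext l
  have := congrFun h (l ++ [1])
  rwa [mul_I_concat, mul_I_concat, mul_one, mul_one] at this

end comp

end Ser

end CFree

namespace CFree

namespace CondProbSpace

variable {A B : Type*} [Ring A] [Algebra ℂ A] [Ring B] [Algebra ℂ B] (S : CondProbSpace A B)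

/-! ### The moment-cumulant relations -/

theorem firstBlocks_length (a : A) (w l : List A) :
    ∀ q ∈ S.firstBlocks a w l, q.1.length ≤ l.length + 1 := by
  induction l generalizing a w with
  | nil => simp [firstBlocks]
  | cons x l ih =>
    intro q hq
    rw [firstBlocks, List.mem_append, List.mem_map] at hq
    rcases hq with hq | ⟨q', hq', rfl⟩
    · have := ih _ _ q hq
      simp; omega
    · simpa using ih _ _ q' hq'

/-- The block made of the whole word is enumerated last and every other block is strictly shorter.
This puts the term isolated in the recursion for `cumulant` back into the sum. For `w = []` both
branches of the `if` give that full block, since `ψ(1) = 1`. -/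
theorem firstBlocks_eq_append (a : A) (w l : List A) :
    ∃ L, S.firstBlocks a w l = L ++ [if l = [] then ([a], w) else (a * S.ι (S.ψ w.prod) :: l, [])] ∧
      ∀ q ∈ L, q.1.length < l.length + 1 := by
  induction l generalizing a w with
  | nil => exact ⟨[], by simp [firstBlocks]⟩
  | cons x l ih =>
    obtain ⟨L, hL, hlen⟩ := ih x []
    refine ⟨S.firstBlocks a (w ++ [x]) l ++
      L.map fun q => (a * S.ι (S.ψ w.prod) :: q.1, q.2), ?_, ?_⟩
    · rw [firstBlocks, hL]
      by_cases h : l = [] <;> simp [h, S.ψ_one]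
    · intro q hq
      rw [List.mem_append, List.mem_map] at hq
      rcases hq with hq | ⟨q', hq', rfl⟩
      · have := S.firstBlocks_length _ _ _ q hq
        simp; omega
      · simpa using hlen q' hq'

/-- The moment-cumulant relation, summed over the block of the first entry. -/
theorem moment_eq_sum_cumulant (E : A →ₗ[ℂ] B) (hE : E 1 = 1) (a : A) (l : List A) :
    E (a :: l).prod =
      ((S.firstBlocks a [] l).map fun q => S.cumulant E q.1 * E q.2.prod).sum := by
  obtain ⟨L, hL, hlen⟩ := S.firstBlocks_eq_append a [] l
  have hlast : (if l = [] then ([a], ([] : List A)) else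
      (a * S.ι (S.ψ ([] : List A).prod) :: l, [])) = (a :: l, []) := by
    by_cases h : l = [] <;> simp [h, S.ψ_one]
  rw [hlast] at hL
  have hc : S.cumulant E (a :: l) = E (a :: l).prod - ((S.firstBlocks a [] l).map fun q =>
      if q.1.length < (a :: l).length then S.cumulant E q.1 * E q.2.prod else 0).sum := by
    rw [cumulant]
    simp only [dite_eq_ite]
  rw [hL] at hc ⊢
  simp only [List.map_append, List.sum_append, List.map_cons, List.map_nil, List.sum_cons,
    List.sum_nil, lt_irrefl, if_false, add_zero, List.prod_nil, hE, mul_one] at hc ⊢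
  have hs : (L.map fun q => if q.1.length < (a :: l).length then
      S.cumulant E q.1 * E q.2.prod else 0) = L.map fun q => S.cumulant E q.1 * E q.2.prod :=
    List.map_congr_left fun q hq => if_pos (by simpa using hlen q hq)
  rw [hc, hs]
  abel

/-- Multiplying the last entry on the right changes `firstBlocks` in the last entries only. -/
theorem firstBlocks_concat_mul (a : A) (w l : List A) (y z : A) :
    List.Forall₂ (fun q q' : List A × List A =>
        (q.1 = q'.1 ∧ ∃ r, q.2 = r ++ [y * z] ∧ q'.2 = r ++ [y]) ∨
        (∃ r, q.1 = r ++ [y * z] ∧ q'.1 = r ++ [y] ∧ q.2 = [] ∧ q'.2 = []))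
      (S.firstBlocks a w (l ++ [y * z])) (S.firstBlocks a w (l ++ [y])) := by
  induction l generalizing a w with
  | nil =>
    simp only [List.nil_append, firstBlocks, List.singleton_append, List.map_cons, List.map_nil]
    refine .cons (.inl ⟨rfl, w, rfl, rfl⟩) (.cons (.inr ⟨[_], rfl, rfl, rfl, rfl⟩) .nil)
  | cons x l ih =>
    simp only [List.cons_append, firstBlocks]
    refine List.rel_append (ih _ _) ?_
    rw [List.forall₂_map_left_iff, List.forall₂_map_right_iff]
    refine (ih x []).imp ?_
    rintro q q' (⟨h, r, h₁, h₂⟩ | ⟨r, h₁, h₂, h₃, h₄⟩)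
    · exact .inl ⟨by rw [h], r, h₁, h₂⟩
    · exact .inr ⟨_ :: r, by rw [h₁]; rfl, by rw [h₂]; rfl, h₃, h₄⟩

theorem sum_eq_of_forall₂ {X Y M : Type*} [AddMonoid M] {R : X → Y → Prop} {f : X → M} {g : Y → M}
    {l : List X} {l' : List Y} (h : List.Forall₂ R l l') (hR : ∀ x ∈ l, ∀ y, R x y → f x = g y) :
    (l.map f).sum = (l'.map g).sum := by
  induction h with
  | nil => rfl
  | cons h _ ih =>
    simp only [List.map_cons, List.sum_cons]
    rw [hR _ (by simp) _ h, ih fun x hx => hR x (by simp [hx])]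

/-- Cumulants are right `B`-linear in the last entry. -/
theorem cumulant_concat_mul (E : A →ₗ[ℂ] B) (hE : E 1 = 1)
    (hbi : ∀ (b b' : B) (x : A), E (S.ι b * x * S.ι b') = b * E x * b') (l : List A) (y : A)
    (b : B) : S.cumulant E (l ++ [y * S.ι b]) = S.cumulant E (l ++ [y]) * b := by
  have hr : ∀ x, E (x * S.ι b) = E x * b := fun x => by simpa using hbi 1 b x
  induction hn : l.length using Nat.strong_induction_on generalizing l y with
  | _ n ih =>
    cases l with
    | nil =>
      have h := fun c => S.moment_eq_sum_cumulant E hE c []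
      simp only [firstBlocks, List.map_cons, List.map_nil, List.sum_cons, List.sum_nil, add_zero,
        List.prod_cons, List.prod_nil, mul_one, hE] at h
      rw [List.nil_append, List.nil_append, ← h, ← h, hr]
    | cons a l =>
      simp only [List.cons_append, cumulant, dite_eq_ite]
      rw [sub_mul]
      congr 1
      · rw [← List.cons_append, ← List.cons_append, List.prod_append, List.prod_append]
        simp [← mul_assoc, hr]
      · rw [← List.sum_map_mul_right]
        refine sum_eq_of_forall₂ (S.firstBlocks_concat_mul a [] l y (S.ι b)) ?_
        rintro q - q' (⟨h, r, h₁, h₂⟩ | ⟨r, h₁, h₂, h₃, h₄⟩)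
        · simp [h, h₁, h₂, ite_mul, ← mul_assoc, hr]
        · simp only [h₁, h₂, h₃, h₄, List.prod_nil, hE, mul_one, List.length_append,
            List.length_cons, List.length_nil, ite_mul, zero_mul]
          refine ite_congr rfl (fun hlt => ?_) fun _ => rfl
          -- A block that ends in the last entry and is not the whole word is shorter, so the
          -- induction hypothesis pulls `b` out of its cumulant.
          exact ih _ (by subst hn; simpa using hlt) r y rfl

/-! ### Generating series and their functional equation -/

open Ser

/-- The series with components `(x b₁, …, x bₙ) ↦ x b₁ ⋯ x bₙ`. -/
def resolvent (x : A) : Ser B A := fun l => (l.map fun b => x * S.ι b).prod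

/-- The cumulant series `(b₁, …, bₙ) ↦ cumulant(x b₁, …, x bₙ, x)`. -/
def cumulantSeries (E : A →ₗ[ℂ] B) (x : A) : Ser B B := fun bs => S.cumulant E (S.cumulantArgs x bs)

/-- The moment series `(b₁, …, bₙ) ↦ E(x b₁ ⋯ x bₙ)`. -/
def momentSeries (E : A →ₗ[ℂ] B) (x : A) : Ser B B := Ser.map E.toAddMonoidHom (S.resolvent x)

theorem momentSeries_apply (E : A →ₗ[ℂ] B) (x : A) (l : List B) :
    S.momentSeries E x l = E (l.map fun b => x * S.ι b).prod := rfl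

/-- Each position of the block together with the gap after it contributes `x b ψ(gap) = x P(b ::
gap)`, which is how the blocks of a composition with `P = I.N` arise. The last position and the
remainder give the factor `G = I.M`, the entry `b` leaving the cumulant by right linearity. For the
induction, `pre` holds the arguments already completed, `b` the current position and `w` the part of
its gap read so far. -/
theorem sum_firstBlocks_eq (E : A →ₗ[ℂ] B) (hE : E 1 = 1)
    (hbi : ∀ (b b' : B) (x : A), E (S.ι b * x * S.ι b') = b * E x * b') (x : A)
    {P G : List B → B} (hP : ∀ b w, P (b :: w) = b * S.ψ (w.map fun b => x * S.ι b).prod)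
    (hG : G [] = 0) (hG' : ∀ b w, G (b :: w) = b * E (w.map fun b => x * S.ι b).prod)
    (pre : List B) (b : B) (w l : List B) :
    ((S.firstBlocks (x * S.ι b) (w.map fun b => x * S.ι b) (l.map fun b => x * S.ι b)).map fun q =>
        S.cumulant E ((pre.map fun b => x * S.ι b) ++ q.1) * E q.2.prod).sum =
      S.cumulant E (S.cumulantArgs x pre) * b * E ((w ++ l).map fun b => x * S.ι b).prod +
        splitSum (fun u v => compFrom (fun r => S.cumulant E (S.cumulantArgs x (pre ++ r)))
          P (b :: w) u * G v) l := by
  induction l generalizing pre b w with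
  | nil =>
    simp [firstBlocks, splitSum, hG, S.cumulant_concat_mul E hE hbi, cumulantArgs]
  | cons c l ih =>
    -- The next letter `c` either lengthens the gap after `b` (`h₁`) or is the next position of the
    -- block, which completes the argument `P(b :: w)` (`h₂`).
    have h₁ := ih pre b (w ++ [c])
    have h₂ := ih (pre ++ [P (b :: w)]) c []
    rw [List.map_append, List.map_cons, List.map_nil] at h₁
    simp only [List.map_append, List.map_cons, List.map_nil, List.append_assoc,
      List.nil_append, List.cons_append, hP, map_mul, ← mul_assoc] at h₂
    simp only [List.map_cons, firstBlocks, List.map_append, List.sum_append, List.map_map,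
      Function.comp_def, h₁, h₂, splitSum, compFrom_cons, compFrom_nil, add_mul, splitSum_add,
      List.cons_append, List.append_assoc, List.nil_append, hG', hP, ← mul_assoc]
    abel

/-- The functional equation of moments and cumulants. -/
theorem momentSeries_eq (E : A →ₗ[ℂ] B) (hE : E 1 = 1)
    (hbi : ∀ (b b' : B) (x : A), E (S.ι b * x * S.ι b') = b * E x * b') (x : A) :
    S.momentSeries E x = 1 + compHom (I B * S.momentSeries S.ψ x) (S.cumulantSeries E x) *
      (I B * S.momentSeries E x) := by
  ext l
  cases l with
  | nil => simp [momentSeries_apply, hE, I_nil]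
  | cons b l =>
    have h := S.moment_eq_sum_cumulant E hE (x * S.ι b) (l.map fun b => x * S.ι b)
    have h' := S.sum_firstBlocks_eq E hE hbi x (P := I B * S.momentSeries S.ψ x)
      (G := I B * S.momentSeries E x) (I_mul_cons _) (by simp [I_nil]) (I_mul_cons _) [] b [] l
    simp only [List.map_nil, List.nil_append] at h'
    rw [h'] at h
    rw [momentSeries_apply, List.map_cons, h, Ser.add_apply, one_cons, zero_add, mul_apply,
      splitSum, compHom_nil, I_mul_cons, ← mul_assoc]
    rfl

end CondProbSpace

end CFree

namespace CFree

set_option linter.unusedSectionVars false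

open Ser

/-! ### The transform of one element -/

section Translations

variable {B : Type*} [Ring B] [Algebra ℂ B]

/-- A unital series as an element of the ring of series. -/
def UnitalSeries.ser (f : UnitalSeries B) : Ser B B := f.toFun

/-- A series starting with `id_B` as an element of the ring of series. -/
def CompSeries.ser (α : CompSeries B) : Ser B B := α.toFun

theorem CompSeries.ser_nil (α : CompSeries B) : α.ser [] = 0 := α.map_nil

theorem CompSeries.compHom_mul_inv (α : CompSeries B) : compHom α⁻¹.ser α.ser = I B :=
  congrArg CompSeries.toFun (mul_inv_cancel α)

theorem UnitalSeries.ser_injective : Function.Injective (UnitalSeries.ser (B := B)) :=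
  fun _ _ h => UnitalSeries.ext h

theorem UnitalSeries.mul_ser (f g : UnitalSeries B) : (f * g).ser = f.ser * g.ser := rfl

theorem UnitalSeries.one_ser : (1 : UnitalSeries B).ser = 1 := by
  ext l
  cases l <;> rfl

theorem UnitalSeries.ser_mul_inv (f : UnitalSeries B) : f.ser * f⁻¹.ser = 1 := by
  rw [← mul_ser, mul_inv_cancel, one_ser]

theorem UnitalSeries.inv_ser_mul (f : UnitalSeries B) : f⁻¹.ser * f.ser = 1 := by
  rw [← mul_ser, inv_mul_cancel, one_ser]

theorem UnitalSeries.eq_inv_ser {f : UnitalSeries B} {x : Ser B B} (h : f.ser * x = 1) :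
    x = f⁻¹.ser := by
  rw [← mul_one f⁻¹.ser, ← h, ← mul_assoc, inv_ser_mul, one_mul]

theorem UnitalSeries.ser_nil (f : UnitalSeries B) : f.ser [] = 1 := f.map_nil

theorem UnitalSeries.act_ser (f : UnitalSeries B) (α : CompSeries B) :
    (f <• α).ser = compHom α.ser f.ser := rfl

variable (B) in
/-- The unital series `1 + I`. -/
def onePlusId : UnitalSeries B where
  toFun := oneSeries + idSeries
  multilinear := .add .oneSeries .idSeries
  map_nil := by simp [oneSeries, idSeries]

theorem onePlusId_ser : (onePlusId B).ser = 1 + I B := by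
  ext l
  cases l <;> rfl

/-- As in `mul_I_cancel`, `f` is `f.I` with last argument `1`. -/
theorem isMultilinear_of_mul_I {f : Ser B B} (h : IsMultilinear (f * I B : Ser B B)) :
    IsMultilinear f := by
  have e : ∀ l, f l = (f * I B) (l ++ [1]) := fun l => by rw [mul_I_concat, mul_one]
  constructor
  · intro l r x y
    simp only [e, List.append_assoc, List.cons_append, h.1]
  · intro c l r x
    simp only [e, List.append_assoc, List.cons_append, h.2]

/-- The series `I.(1 + I)⁻¹.T⁻¹`. -/
def inverseArgument (T : UnitalSeries B) : Ser B B := I B * ((onePlusId B)⁻¹ * T⁻¹).ser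

theorem inverseArgument_nil (T : UnitalSeries B) : inverseArgument T [] = 0 := by
  simp [inverseArgument, I_nil]

/-- The series is `I` times an invertible one, so only `I` has to be cancelled. -/
theorem mul_inverseArgument_cancel {f g : Ser B B} (T : UnitalSeries B)
    (h : f * inverseArgument T = g * inverseArgument T) : f = g := by
  apply mul_I_cancel
  have h' := congrArg (· * ((onePlusId B)⁻¹ * T⁻¹)⁻¹.ser) h
  simpa only [inverseArgument, mul_assoc, UnitalSeries.ser_mul_inv, mul_one] using h'

/-- `1 - T.I.(1 + I)⁻¹.T⁻¹ = T.(1 + I)⁻¹.T⁻¹`. -/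
theorem one_sub_mul_inverseArgument (T : UnitalSeries B) :
    1 - T.ser * inverseArgument T = (T * (onePlusId B)⁻¹ * T⁻¹).ser := by
  have h : I B = (onePlusId B).ser - 1 := by rw [onePlusId_ser]; abel
  rw [inverseArgument, h, sub_mul, one_mul, ← UnitalSeries.mul_ser, mul_inv_cancel_left, mul_sub,
    UnitalSeries.ser_mul_inv, ← UnitalSeries.mul_ser, mul_assoc]
  abel

end Translations

/-! ### Passing between the transform and the moment series -/

namespace CondProbSpace

variable {A B : Type*} [Ring A] [Algebra ℂ A] [Ring B] [Algebra ℂ B] (S : CondProbSpace A B)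

theorem momentSeries_multilinear (E : A →ₗ[ℂ] B) (x : A) :
    IsMultilinear (S.momentSeries E x) := by
  constructor
  · intro l r y z
    simp [momentSeries_apply, mul_add, add_mul]
  · intro c l r y
    simp [momentSeries_apply]

/-- The moment series as a unital series. -/
def momentUnital (E : A →ₗ[ℂ] B) (hE : E 1 = 1) (x : A) : UnitalSeries B where
  toFun := S.momentSeries E x
  multilinear := S.momentSeries_multilinear E x
  map_nil := by simp [momentSeries_apply, hE]

theorem momentUnital_ser (E : A →ₗ[ℂ] B) (hE : E 1 = 1) (x : A) :
    (S.momentUnital E hE x).ser = S.momentSeries E x := rfl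

/-- The series `I.N` for the moment series `N` of `ψ`. -/
def momentComp (x : A) : CompSeries B := leftTranslation (S.momentUnital S.ψ S.ψ_one x)

variable {E : A →ₗ[ℂ] B} (hE : E 1 = 1)
    (hbi : ∀ (b b' : B) (x : A), E (S.ι b * x * S.ι b') = b * E x * b')

include hE hbi

theorem cumulantSeries_nil (x : A) : S.cumulantSeries E x [] = E x := by
  have h := S.moment_eq_sum_cumulant E hE x []
  simpa [firstBlocks, hE, cumulantSeries, cumulantArgs] using h.symm

/-- The recursion for cumulants does not show linearity, so it is transferred from the moments by
solving the functional equation for the cumulant series. It is needed because associativity of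
composition requires a multilinear outer series. -/
theorem cumulantSeries_multilinear (x : A) : IsMultilinear (S.cumulantSeries E x) := by
  set N := S.momentUnital E hE x with hN
  set X : Ser B B := compHom (I B * S.momentSeries S.ψ x) (S.cumulantSeries E x) with hX
  have h : N.ser = 1 + X * (I B * N.ser) := S.momentSeries_eq E hE hbi x
  -- The equation `N = 1 + X.I.N` is multiplied by `N⁻¹` on the right.
  have hXI : X * I B = 1 - N⁻¹.ser := by
    calc X * I B = (1 + X * (I B * N.ser)) * N⁻¹.ser - N⁻¹.ser := by
          rw [add_mul, mul_assoc X, mul_assoc (I B), UnitalSeries.ser_mul_inv]; simp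
      _ = _ := by rw [← h, UnitalSeries.ser_mul_inv]
  have hXm : IsMultilinear X := by
    apply isMultilinear_of_mul_I
    rw [hXI, ← UnitalSeries.one_ser]
    exact (1 : UnitalSeries B).multilinear.sub N⁻¹.multilinear
  set P := S.momentComp x
  have hK : S.cumulantSeries E x = compHom P⁻¹.ser X := by
    apply compHom_injective (β := P.ser) P.map_singleton
    have e := P⁻¹.compHom_mul_inv
    rw [inv_inv] at e
    rw [compHom_compHom hXm, e, compHom_by_I hXm]
    rfl
  rw [hK]
  exact hXm.comp P⁻¹.multilinear

/-- The moment series after substitution of `I.(1 + I)⁻¹.T⁻¹`, for the transform `(T, T')`. -/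
theorem compHom_momentSeries {x : A} {T T' : UnitalSeries B}
    (hT : compHom (I B * T⁻¹.ser) (S.cumulantSeries S.ψ x) = T.ser)
    (hT' : compHom (I B * T⁻¹.ser) (S.cumulantSeries E x) = T'.ser) :
    compHom (inverseArgument T) (S.momentSeries E x) =
      1 + T'.ser * inverseArgument T * compHom (inverseArgument T) (S.momentSeries E x) := by
  set P := S.momentComp x with hP
  set p : Ser B B := I B * S.momentSeries S.ψ x with hp
  set Q : Ser B B := P⁻¹.ser with hQ
  set V : Ser B B := I B * T⁻¹.ser with hV
  have hV0 : V [] = 0 := by simp [hV, I_nil]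
  have hpm : IsMultilinear p := P.multilinear
  have hpQ : compHom Q p = I B := P.compHom_mul_inv
  have hKm := S.cumulantSeries_multilinear S.ψ_one S.ψ_bimodule x
  -- The functional equation of `ψ`, multiplied by `I` on the left, is composed with the
  -- compositional inverse `Q` of `p = I.N`.
  have hI : I B = Q + Q * (S.cumulantSeries S.ψ x * I B) := by
    have h : p = I B + I B * (compHom p (S.cumulantSeries S.ψ x) * p) := by
      conv_lhs => rw [hp, S.momentSeries_eq S.ψ S.ψ_one S.ψ_bimodule x]
      rw [mul_add, mul_one]
    have h' : compHom Q p = compHom Q (I B) +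
        compHom Q (I B) * (compHom Q (compHom p (S.cumulantSeries S.ψ x)) * compHom Q p) := by
      simpa only [map_add, map_mul] using congrArg (compHom Q) h
    rwa [compHom_compHom hKm, hpQ, compHom_I P⁻¹.ser_nil, compHom_by_I hKm] at h'
  -- Composing `hI` with `V = I.T⁻¹` turns the cumulant series into `T`, and `1 + T.V = T.(1 +
  -- I).T⁻¹`. Solving for `Q ∘ V` produces `I.(1 + I)⁻¹.T⁻¹`, which explains the choice of
  -- `inverseArgument`.
  have hVQ : V = compHom V Q * (T * onePlusId B * T⁻¹).ser := by
    have h := congrArg (compHom V) hI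
    rw [map_add, map_mul, map_mul, compHom_I hV0, hT] at h
    calc V = compHom V Q * (1 + T.ser * V) := by rw [mul_add, mul_one]; exact h
      _ = _ := by
        simp only [hV, UnitalSeries.mul_ser, onePlusId_ser, mul_add, add_mul, mul_one, one_mul,
          mul_assoc, UnitalSeries.ser_mul_inv]
  have hUQ : inverseArgument T = compHom V Q := by
    have h := congrArg (· * (T * onePlusId B * T⁻¹)⁻¹.ser) hVQ
    simp only [mul_assoc, UnitalSeries.ser_mul_inv, mul_one] at h
    rw [← h, inverseArgument, hV, mul_assoc, ← UnitalSeries.mul_ser]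
    congr 2
    group
  have hpU : compHom (inverseArgument T) p = V := by
    rw [hUQ, ← compHom_compHom hpm, hpQ, compHom_I hV0]
  have h := congrArg (compHom (inverseArgument T)) (S.momentSeries_eq E hE hbi x)
  rwa [map_add, map_one, map_mul, map_mul,
    compHom_compHom (S.cumulantSeries_multilinear hE hbi x), ← hp, hpU, hT',
    compHom_I (inverseArgument_nil T), ← mul_assoc] at h

/-- Conversely, the equations of `compHom_momentSeries` characterize the transform. -/
theorem compHom_cumulantSeries {x : A} {T T' : UnitalSeries B}
    (hT : compHom (inverseArgument T) (S.momentSeries S.ψ x) = 1 + T.ser * inverseArgument T *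
      compHom (inverseArgument T) (S.momentSeries S.ψ x))
    (hT' : compHom (inverseArgument T) (S.momentSeries E x) = 1 + T'.ser * inverseArgument T *
      compHom (inverseArgument T) (S.momentSeries E x)) :
    compHom (I B * T⁻¹.ser) (S.cumulantSeries E x) = T'.ser := by
  set U := inverseArgument T with hU
  set n := compHom U (S.momentSeries S.ψ x) with hn
  have hU0 : U [] = 0 := inverseArgument_nil T
  -- The hypothesis for `ψ` determines `n` as the inverse of `1 - T.U`; multiplying by `U` then
  -- gives `(I.N) ∘ U = I.T⁻¹`.
  have hn' : n = (T * onePlusId B * T⁻¹).ser := by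
    have h : (T * (onePlusId B)⁻¹ * T⁻¹).ser * n = 1 := by
      rw [← one_sub_mul_inverseArgument, sub_mul, one_mul, sub_eq_iff_eq_add]
      exact hT
    rw [UnitalSeries.eq_inv_ser h]
    congr 1
    group
  have hpU : compHom U (I B * S.momentSeries S.ψ x) = I B * T⁻¹.ser := by
    rw [map_mul, compHom_I hU0, ← hn, hn', hU, inverseArgument, mul_assoc, ← UnitalSeries.mul_ser]
    congr 2
    group
  have h := congrArg (compHom U) (S.momentSeries_eq E hE hbi x)
  rw [map_add, map_one, map_mul, map_mul,
    compHom_compHom (S.cumulantSeries_multilinear hE hbi x), hpU, compHom_I hU0,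
    ← mul_assoc] at h
  have h' := add_left_cancel (h.symm.trans hT')
  -- Both `K ∘ (I.T⁻¹)` and `T'` now occur in front of `U.(M ∘ U)`; here `M ∘ U` is made
  -- cancellable, and `U` is cancelled at the end.
  have hinv : compHom U (S.momentSeries E x) * compHom U (S.momentUnital E hE x)⁻¹.ser = 1 := by
    rw [← map_mul, ← S.momentUnital_ser E hE, UnitalSeries.ser_mul_inv, map_one]
  have h'' := congrArg (· * compHom U (S.momentUnital E hE x)⁻¹.ser) h'
  simp only [mul_assoc, hinv, mul_one] at h''
  exact mul_inverseArgument_cancel T h''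

omit hE hbi

/-- The cumulant series of an element of mean one, as a unital series. -/
def cumulantUnital (hE : E 1 = 1)
    (hbi : ∀ (b b' : B) (x : A), E (S.ι b * x * S.ι b') = b * E x * b') (x : A) (hx : E x = 1) :
    UnitalSeries B where
  toFun := S.cumulantSeries E x
  multilinear := S.cumulantSeries_multilinear hE hbi x
  map_nil := (S.cumulantSeries_nil hE hbi x).trans hx

theorem isCondTTransform_iff_relativeTransform {x : A} (hψ : S.ψ x = 1) (hφ : S.φ x = 1)
    (t : UnitalSeries B × UnitalSeries B) :
    S.IsCondTTransform x t ↔ relativeTransform lam (MulOpposite.op t.1, MulOpposite.op t.2) =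
      ⟨MulOpposite.op (S.cumulantUnital S.ψ_one S.ψ_bimodule x hψ),
        MulOpposite.op (S.cumulantUnital S.φ_one S.φ_bimodule x hφ)⟩ := by
  rw [Crossed.ext_iff]
  constructor
  · rintro ⟨h₁, h₂⟩
    exact ⟨MulOpposite.unop_injective (UnitalSeries.ext h₁),
      MulOpposite.unop_injective (UnitalSeries.ext h₂)⟩
  · rintro ⟨h₁, h₂⟩
    rw [IsCondTTransform, h₁, h₂]
    exact ⟨rfl, rfl⟩

/-- The relative transform is a composite of two group inversions, hence bijective; mean one places
the cumulant series in its target. -/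
theorem existsUnique_isCondTTransform {x : A} (hψ : S.ψ x = 1) (hφ : S.φ x = 1) :
    ∃! t, S.IsCondTTransform x t := by
  simp only [S.isCondTTransform_iff_relativeTransform hψ hφ, relativeTransform, inv_eq_iff_eq_inv]
  generalize (⟨_, _⟩ : Crossed (lam (B := B)))⁻¹ = c
  refine ⟨(c.base.unop⁻¹, c.fiber.unop⁻¹), by ext <;> simp, ?_⟩
  rintro ⟨t₁, t₂⟩ h
  simp [← h]

/-- The inverse in the crossed product is explicit: both components of `e(T, T')` are obtained by
acting with the inverse of `λ(T⁻¹) = I.T⁻¹`. Moving this action to the other side leaves no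
compositional inverse. -/
theorem isCondTTransform_iff {x : A} (hψ : S.ψ x = 1) (hφ : S.φ x = 1)
    (t : UnitalSeries B × UnitalSeries B) :
    S.IsCondTTransform x t ↔
      compHom (I B * t.1⁻¹.ser) (S.cumulantSeries S.ψ x) = t.1.ser ∧
      compHom (I B * t.1⁻¹.ser) (S.cumulantSeries S.φ x) = t.2.ser := by
  have key : ∀ f k : UnitalSeries B, MulOpposite.op f <• (lam (MulOpposite.op t.1)⁻¹)⁻¹ =
      MulOpposite.op k ↔ compHom (I B * t.1⁻¹.ser) k.ser = f.ser := by
    intro f k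
    have h : (k <• lam (MulOpposite.op t.1)⁻¹).ser = compHom (I B * t.1⁻¹.ser) k.ser := rfl
    rw [← h, UnitalSeries.ser_injective.eq_iff, MulOpposite.op_inv, inv_smul_eq_iff, eq_comm]
    exact MulOpposite.op_injective.eq_iff (a := k <• lam (MulOpposite.op t.1)⁻¹)
  rw [S.isCondTTransform_iff_relativeTransform hψ hφ, Crossed.ext_iff]
  simp only [relativeTransform, Crossed.inv_base, Crossed.inv_fiber, inv_inv]
  rw [key, key]
  rfl

end CondProbSpace

end CFree

namespace CFree

open Ser

/-! ### Conditional freeness for series -/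

/-- The factorization behind the multiplicativity of the transform. -/
theorem resolvent_factorization {R : Type*} [Ring R] {x a b y u v t t' s w : R}
    (hx : x = 1 + x * a * u) (hy : y = 1 + b * v * y) (ht : t' * t = 1) (hs : s * w = 1)
    (hs' : w * s = 1) (hut : u * t = 1 - w) :
    x * (1 - a * b * (v * t')) * t * y = t * s - (x * a - t * s) * w * (y - s) := by
  have h₁ : x * t = t + x * a * (1 - w) := by
    conv_lhs => rw [hx, add_mul, one_mul, mul_assoc (x * a), hut]
  have h₂ : b * v * y = y - 1 := eq_sub_of_add_eq' hy.symm
  -- Since `t' t = 1`, the product `a b` only meets `y` through `b v y = y - 1`, so the term with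
  -- both `a` and `b` reduces to `x a (y - 1)`.
  calc x * (1 - a * b * (v * t')) * t * y = x * t * y - x * a * (b * v * ((t' * t) * y)) := by
        noncomm_ring
    _ = t * y + x * a * (1 - w) * y - x * a * (y - 1) := by
        rw [ht, one_mul, h₂, h₁, add_mul]
    _ = t * y - x * a * w * y + x * a := by noncomm_ring
    _ = t * s - (x * a * w * y - x * a * (w * s) - t * (s * w) * y + t * (s * w) * s) := by
        rw [hs, hs']; noncomm_ring
    _ = _ := by noncomm_ring

namespace CondProbSpace

variable {A B : Type*} [Ring A] [Algebra ℂ A] [Ring B] [Algebra ℂ B] (S : CondProbSpace A B)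

theorem ι_mem_generated (x : A) (b : B) : S.ι b ∈ S.generated x :=
  Algebra.subset_adjoin (.inl ⟨b, rfl⟩)

theorem self_mem_generated (x : A) : x ∈ S.generated x := Algebra.subset_adjoin (.inr rfl)

/-- The series with coefficients in the algebra generated by `B` and `x`. -/
def HasCoeffs (x : A) (X : Ser B A) : Prop := ∀ l, X l ∈ S.generated x

/-- The embedding of the series over `B` into the series over `A`. -/
def emb : Ser B B →+* Ser B A := mapRing (S.ι : B →+* A)

variable {S}

theorem HasCoeffs.mul {x : A} {X Y : Ser B A} (hX : S.HasCoeffs x X) (hY : S.HasCoeffs x Y) :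
    S.HasCoeffs x (X * Y) := fun l =>
  splitSum_mem (Subalgebra.toSubmodule (S.generated x)).toAddSubmonoid _ l fun u v =>
    (S.generated x).mul_mem (hX u) (hY v)

theorem HasCoeffs.sub {x : A} {X Y : Ser B A} (hX : S.HasCoeffs x X) (hY : S.HasCoeffs x Y) :
    S.HasCoeffs x (X - Y) := fun l => sub_mem (hX l) (hY l)

theorem HasCoeffs.emb (x : A) (f : Ser B B) : S.HasCoeffs x (S.emb f) := fun l =>
  S.ι_mem_generated x (f l)

theorem HasCoeffs.const {x y : A} (hy : y ∈ S.generated x) : S.HasCoeffs x (Ser.const y) := by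
  intro l
  cases l
  · exact hy
  · exact zero_mem _

theorem HasCoeffs.compHom {x : A} {X : Ser B A} (hX : S.HasCoeffs x X) (β : Ser B B) :
    S.HasCoeffs x (compHom β X) := by
  intro l
  refine list_sum_mem fun y hy => ?_
  obtain ⟨c, -, rfl⟩ := List.mem_map.1 hy
  exact hX _

variable (S) in
theorem resolvent_hasCoeffs (x : A) : S.HasCoeffs x (S.resolvent x) := by
  intro l
  refine list_prod_mem fun y hy => ?_
  obtain ⟨b, -, rfl⟩ := List.mem_map.1 hy
  exact mul_mem (S.self_mem_generated x) (S.ι_mem_generated x b)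

variable (S) in
/-- The series with `ψ`-centred coefficients in the algebra generated by `B` and `x`. -/
def IsCentred (x : A) (X : Ser B A) : Prop := S.HasCoeffs x X ∧ Ser.map S.ψ.toAddMonoidHom X = 0

theorem map_emb_mul_mul {E : A →ₗ[ℂ] B}
    (hbi : ∀ (b b' : B) (x : A), E (S.ι b * x * S.ι b') = b * E x * b') (f g : Ser B B)
    (X : Ser B A) : Ser.map E.toAddMonoidHom (S.emb f * X * S.emb g) =
      f * Ser.map E.toAddMonoidHom X * g :=
  map_bimodule (S.ι : B →+* A) E.toAddMonoidHom hbi f g X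

theorem map_mul_emb {E : A →ₗ[ℂ] B}
    (hbi : ∀ (b b' : B) (x : A), E (S.ι b * x * S.ι b') = b * E x * b') (g : Ser B B)
    (X : Ser B A) : Ser.map E.toAddMonoidHom (X * S.emb g) = Ser.map E.toAddMonoidHom X * g := by
  simpa using map_emb_mul_mul hbi 1 g X

theorem map_one_eq {E : A →ₗ[ℂ] B} (hE : E 1 = 1) :
    Ser.map E.toAddMonoidHom (1 : Ser B A) = 1 := by
  ext l
  cases l
  · exact hE
  · exact map_zero E

theorem map_emb {E : A →ₗ[ℂ] B} (hE : E 1 = 1)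
    (hbi : ∀ (b b' : B) (x : A), E (S.ι b * x * S.ι b') = b * E x * b') (f : Ser B B) :
    Ser.map E.toAddMonoidHom (S.emb f) = f := by
  have h := map_mul_emb hbi f (1 : Ser B A)
  rwa [one_mul, map_one_eq hE, one_mul] at h

theorem IsCentred.emb_mul_mul {x : A} {X : Ser B A} (hX : S.IsCentred x X) (f g : Ser B B) :
    S.IsCentred x (S.emb f * X * S.emb g) :=
  ⟨((HasCoeffs.emb x f).mul hX.1).mul (HasCoeffs.emb x g), by
    rw [map_emb_mul_mul S.ψ_bimodule, hX.2, mul_zero, zero_mul]⟩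

theorem IsCentred.sub_emb {x : A} {X : Ser B A} (hX : S.HasCoeffs x X) {f : Ser B B}
    (hf : Ser.map S.ψ.toAddMonoidHom X = f) : S.IsCentred x (X - S.emb f) :=
  ⟨hX.sub (HasCoeffs.emb x f), by rw [map_sub, hf, map_emb S.ψ_one S.ψ_bimodule, sub_self]⟩

/-! ### Multiplicativity on alternating words of series -/

/-- `E` is multiplicative on the alternating words of `ψ`-centred elements. -/
def IsAltMultiplicative (S : CondProbSpace A B) (E : A →ₗ[ℂ] B) (a b : A) : Prop :=
  ∀ w, S.IsAlternatingCentred a b w → E (w.map Prod.snd).prod = (w.map fun q => E q.2).prod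

/-- On centred words both sides vanish. Thus freeness for `ψ` takes the same form as the condition
on `φ`, and one argument serves both functionals. -/
theorem CondFree.isAltMultiplicative_ψ {a b : A} (h : S.CondFree a b) :
    S.IsAltMultiplicative S.ψ a b := by
  intro w hw
  rw [h.1 w hw]
  obtain ⟨q, hq⟩ := List.exists_mem_of_ne_nil w hw.1
  exact (List.prod_eq_zero (List.mem_map.2 ⟨q, hq, (hw.2.2 q hq).2⟩)).symm

/-- Coefficients of centred series are centred elements. The induction moves one coefficient at a
time from the series in `ps` to the word `w`, and freeness is used only once `ps` is exhausted. -/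
theorem IsAltMultiplicative.apply_mul_prod {E : A →ₗ[ℂ] B} (hE : E 1 = 1) {a b : A}
    (h : S.IsAltMultiplicative E a b) (ps : List (Bool × Ser B A))
    (hps : ∀ p ∈ ps, S.IsCentred (if p.1 = true then a else b) p.2) (w : List (Bool × A))
    (hw : ∀ q ∈ w, q.2 ∈ S.generated (if q.1 = true then a else b) ∧ S.ψ q.2 = 0)
    (hc : (w.map Prod.fst ++ ps.map Prod.fst).IsChain (· ≠ ·)) (l : List B) :
    E ((w.map Prod.snd).prod * (ps.map Prod.snd).prod l) =
      (w.map fun q => E q.2).prod *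
        (ps.map fun p => Ser.map E.toAddMonoidHom p.2).prod l := by
  induction ps generalizing w l with
  | nil =>
    cases l with
    | cons c l => simp
    | nil =>
      simp only [List.map_nil, List.prod_nil, one_nil, mul_one]
      by_cases hn : w = []
      · simp [hn, hE]
      · refine h w ⟨hn, ?_, hw⟩
        rw [List.map_nil, List.append_nil, List.isChain_map] at hc
        exact hc
  | cons p ps ih =>
    simp only [List.map_cons, List.prod_cons, mul_apply]
    have e₁ := map_splitSum ((E.toAddMonoidHom).comp (AddMonoidHom.mulLeft (w.map Prod.snd).prod))
      (fun u v => p.2 u * (ps.map Prod.snd).prod v) l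
    have e₂ := map_splitSum (AddMonoidHom.mulLeft (w.map fun q => E q.2).prod)
      (fun u v => Ser.map E.toAddMonoidHom p.2 u *
        (ps.map fun p => Ser.map E.toAddMonoidHom p.2).prod v) l
    refine e₁.trans (Eq.trans ?_ e₂.symm)
    refine splitSum_congr fun u v _ => ?_
    have hp := hps p (by simp)
    have := ih (fun p hp => hps p (by simp [hp])) (w ++ [(p.1, p.2 u)])
      (by
        intro q hq
        rw [List.mem_append, List.mem_singleton] at hq
        rcases hq with hq | rfl
        · exact hw q hq
        · exact ⟨hp.1 u, congrFun hp.2 u⟩)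
      (by simpa using hc) v
    simpa [mul_assoc] using this

theorem IsAltMultiplicative.map_prod {E : A →ₗ[ℂ] B} (hE : E 1 = 1) {a b : A}
    (h : S.IsAltMultiplicative E a b) (ps : List (Bool × Ser B A))
    (hps : ∀ p ∈ ps, S.IsCentred (if p.1 = true then a else b) p.2)
    (hc : (ps.map Prod.fst).IsChain (· ≠ ·)) :
    Ser.map E.toAddMonoidHom (ps.map Prod.snd).prod =
      (ps.map fun p => Ser.map E.toAddMonoidHom p.2).prod := by
  ext l
  simpa using h.apply_mul_prod hE ps hps [] (by simp) (by simpa using hc) l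

/-- The word `(α β)ⁿ` followed by `l`. -/
def altWord {X : Type*} (α β : X) : ℕ → List (Bool × X) → List (Bool × X)
  | 0, l => l
  | n + 1, l => (true, α) :: (false, β) :: altWord α β n l

theorem altWord_prod {X R : Type*} [Ring R] (f : X → R) (α β : X) (n : ℕ) (l : List (Bool × X)) :
    ((altWord α β n l).map fun p => f p.2).prod =
      (f α * f β) ^ n * (l.map fun p => f p.2).prod := by
  induction n with
  | zero => simp [altWord]
  | succ n ih => simp [altWord, ih, pow_succ', mul_assoc]

theorem altWord_isChain {X : Type*} (α β : X) (n : ℕ) (l : List (Bool × X))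
    (hl : (false :: l.map Prod.fst).IsChain (· ≠ ·)) :
    (false :: (altWord α β n l).map Prod.fst).IsChain (· ≠ ·) := by
  induction n with
  | zero => exact hl
  | succ n ih =>
    simp only [altWord, List.map_cons, List.isChain_cons_cons]
    exact ⟨by simp, by simp, ih⟩

theorem mem_altWord {X : Type*} {α β : X} {n : ℕ} {l : List (Bool × X)} {p : Bool × X}
    (hp : p ∈ altWord α β n l) : p = (true, α) ∨ p = (false, β) ∨ p ∈ l := by
  induction n with
  | zero => exact .inr (.inr hp)
  | succ n ih =>
    simp only [altWord, List.mem_cons] at hp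
    tauto

/-- These are the terms of the geometric series for the product. Expanding the outer factors leaves
alternating words, with or without a head `β'` and a tail `α'`; the constant `c` leaves by right
`B`-linearity. -/
theorem IsAltMultiplicative.map_alternating {E : A →ₗ[ℂ] B} (hE : E 1 = 1)
    (hbi : ∀ (b b' : B) (x : A), E (S.ι b * x * S.ι b') = b * E x * b') {a b : A}
    (h : S.IsAltMultiplicative E a b) {α α' β β' : Ser B A} (hα : S.IsCentred a α)
    (hα' : S.IsCentred a α') (hβ : S.IsCentred b β) (hβ' : S.IsCentred b β') (n : ℕ)
    (c : Ser B B) :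
    Ser.map E.toAddMonoidHom ((1 + β') * (α * β) ^ n * (S.emb c + α')) =
      (1 + Ser.map E.toAddMonoidHom β') *
        (Ser.map E.toAddMonoidHom α * Ser.map E.toAddMonoidHom β) ^ n *
          (c + Ser.map E.toAddMonoidHom α') := by
  have key : ∀ pre tail : List (Bool × Ser B A), (pre = [] ∨ pre = [(false, β')]) →
      (tail = [] ∨ tail = [(true, α')]) →
      Ser.map E.toAddMonoidHom ((pre ++ altWord α β n tail).map Prod.snd).prod =
        ((pre ++ altWord α β n tail).map fun p => Ser.map E.toAddMonoidHom p.2).prod := by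
    intro pre tail hpre htail
    refine h.map_prod hE _ (fun p hp => ?_) ?_
    · have : p = (false, β') ∨ p = (true, α) ∨ p = (false, β) ∨ p = (true, α') := by
        rcases List.mem_append.1 hp with hp | hp
        · rcases hpre with rfl | rfl <;> simp at hp
          exact .inl hp
        · rcases mem_altWord hp with hp | hp | hp
          · exact .inr (.inl hp)
          · exact .inr (.inr (.inl hp))
          · rcases htail with rfl | rfl <;> simp at hp
            exact .inr (.inr (.inr hp))
      rcases this with rfl | rfl | rfl | rfl <;> simpa
    · have hch := altWord_isChain α β n tail (by rcases htail with rfl | rfl <;> simp)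
      rcases hpre with rfl | rfl
      · exact hch.tail
      · simpa using hch
  have k₁ := key [] [] (.inl rfl) (.inl rfl)
  have k₂ := key [] [(true, α')] (.inl rfl) (.inr rfl)
  have k₃ := key [(false, β')] [] (.inr rfl) (.inl rfl)
  have k₄ := key [(false, β')] [(true, α')] (.inr rfl) (.inr rfl)
  have e := altWord_prod (fun X : Ser B A => X) α β n
  simp only [List.map_append, List.prod_append, List.map_nil, List.prod_nil, one_mul, mul_one,
    altWord_prod, e, List.map_cons, List.prod_cons, ← mul_assoc] at k₁ k₂ k₃ k₄
  simp only [add_mul, mul_add, one_mul, map_add, map_mul_emb hbi, k₁, k₂, k₃, k₄]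

/-- The moments of a product of conditionally free elements. -/
theorem IsAltMultiplicative.map_resolvent_mul {E : A →ₗ[ℂ] B} (hE : E 1 = 1)
    (hbi : ∀ (b b' : B) (x : A), E (S.ι b * x * S.ι b') = b * E x * b') {a b : A}
    (h : S.IsAltMultiplicative E a b) {t t' s w u v p q : Ser B B} {X Y W : Ser B A}
    (htt' : t * t' = 1) (ht't : t' * t = 1) (hsw : s * w = 1) (hws : w * s = 1)
    (hut : u * t = 1 - w) (hv : v [] = 0) (hs : s [] = 1)
    (hX : X = 1 + X * Ser.const a * S.emb u) (hY : Y = 1 + Ser.const b * S.emb v * Y)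
    (hY' : Y = 1 + Y * (Ser.const b * S.emb v))
    (hW : W = 1 + Ser.const (a * b) * S.emb (v * t') * W)
    (hXa : S.HasCoeffs a X) (hYb : S.HasCoeffs b Y)
    (hψX : Ser.map S.ψ.toAddMonoidHom (X * Ser.const a) = t * s)
    (hψY : Ser.map S.ψ.toAddMonoidHom Y = s)
    (hEX : Ser.map E.toAddMonoidHom (X * Ser.const a) = Ser.map E.toAddMonoidHom X * p)
    (hEX' : Ser.map E.toAddMonoidHom X = 1 + p * u * Ser.map E.toAddMonoidHom X)
    (hEY : Ser.map E.toAddMonoidHom Y = 1 + q * v * Ser.map E.toAddMonoidHom Y) :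
    Ser.map E.toAddMonoidHom W = 1 + p * q * (v * t') * Ser.map E.toAddMonoidHom W := by
  set j := S.emb
  set M : Ser B A →+ Ser B B := Ser.map E.toAddMonoidHom with hM
  set α : Ser B A := X * Ser.const a - j (t * s) with hα
  set β : Ser B A := Y - j s with hβ
  have hαc : S.IsCentred a α :=
    .sub_emb (hXa.mul (HasCoeffs.const (S.self_mem_generated a))) hψX
  have hβc : S.IsCentred b β := .sub_emb hYb hψY
  have hMα : M α = M X * p - t * s := by rw [hα, map_sub, hEX, hM, map_emb hE hbi]
  have hMβ : M β = M Y - s := by rw [hβ, map_sub, hM, map_emb hE hbi]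
  have hY0 : Y [] = 1 := by
    rw [hY]
    change 1 + (b * S.ι (v [])) * Y [] = 1
    simp [hv]
  -- Only `β` is sure to have no constant term, but this suffices for the powers of `α.β₁` to vanish
  -- to increasing order.
  have hβ0 : β [] = 0 := by
    change Y [] - S.ι (s []) = 0
    simp [hY0, hs]
  have jtt' : j t * j t' = 1 := by rw [← map_mul, htt', map_one]
  have jt't : j t' * j t = 1 := by rw [← map_mul, ht't, map_one]
  have jsw : j s * j w = 1 := by rw [← map_mul, hsw, map_one]
  have jws : j w * j s = 1 := by rw [← map_mul, hws, map_one]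
  have jut : j u * j t = 1 - j w := by rw [← map_mul, hut, map_sub, map_one]
  have fA := resolvent_factorization hX hY jt't jsw jws jut
  have hMX : M X = 1 + M X * p * u := by
    conv_lhs => rw [hX]
    rw [map_add, hM, map_one_eq hE, map_mul_emb hbi, hEX]
  have fB := resolvent_factorization hMX hEY ht't hsw hws hut
  rw [← map_mul j t s, ← hα, ← hβ] at fA
  -- `fA` and `fB` are one identity, in the series over `A` and over `B`; `E` sends the centred
  -- factors of `fA` to those of `fB`.
  rw [← hMα, ← hMβ] at fB
  set β₁ : Ser B A := j w * β * j (w * t') with hβ₁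
  set β₂ : Ser B A := j t * β * j (w * t') with hβ₂
  set α₁ : Ser B A := α * j u with hα₁
  have hα₁c : S.IsCentred a α₁ := by simpa using hαc.emb_mul_mul 1 u
  have hX₁ : X = j (1 + t * s * u) + α₁ := by
    conv_lhs => rw [hX]
    rw [hα₁, hα, map_add, map_one, map_mul j (t * s) u]
    noncomm_ring
  have hD : j t * Y * j (w * t') = 1 + β₂ := by
    have e : j t * j s * j (w * t') = 1 := by
      rw [map_mul, mul_assoc, ← mul_assoc (j s), jsw, one_mul, jtt']
    rw [hβ₂, hβ, mul_sub, sub_mul, e]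
    abel
  have hD' : 1 + M β₂ = t * M Y * (w * t') := by
    have e : t * s * (w * t') = 1 := by rw [mul_assoc, ← mul_assoc s, hsw, one_mul, htt']
    rw [hβ₂, hM, map_emb_mul_mul hbi, ← hM, hMβ, mul_sub, sub_mul, e]
    abel
  have hYY : Y * (1 - Ser.const b * j v) = 1 := by
    rw [mul_sub, mul_one]; exact sub_eq_of_eq_add hY'
  have hWW : (1 - Ser.const a * Ser.const b * (j v * j t')) * W = 1 := by
    rw [Ser.const_mul_const, ← map_mul, sub_mul, one_mul]; exact sub_eq_of_eq_add hW
  -- `Z` plays the role of `(1 - α.β₁)⁻¹.X`; it is written through `W` so that no inverse has to be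
  -- constructed.
  set Z : Ser B A := j (t * s) * (1 - Ser.const b * j v) * j t' * W with hZ
  have hZX : (1 - α * β₁) * Z = X := by
    have e : (1 - α * β₁) * j (t * s) = j (t * s) - α * j w * β := by
      have e' : j (w * t') * j (t * s) = 1 := by
        rw [← map_mul, mul_assoc, ← mul_assoc t', ht't, one_mul, hws, map_one]
      rw [sub_mul, one_mul, hβ₁, mul_assoc α, mul_assoc (j w * β), e', mul_one, mul_assoc α]
    calc (1 - α * β₁) * Z = ((1 - α * β₁) * j (t * s)) * (1 - Ser.const b * j v) * j t' * W := by
          rw [hZ]; simp only [mul_assoc]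
      _ = X * (1 - Ser.const a * Ser.const b * (j v * j t')) * j t *
            (Y * (1 - Ser.const b * j v)) * j t' * W := by
          rw [e, ← fA]; simp only [mul_assoc]
      _ = X * ((1 - Ser.const a * Ser.const b * (j v * j t')) * ((j t * j t') * W)) := by
          rw [hYY, mul_one]; simp only [mul_assoc]
      _ = X := by rw [jtt', one_mul, hWW, mul_one]
  have hWZ : W = (1 + β₂) * Z := by
    have e : j (w * t') * j (t * s) = 1 := by
      rw [← map_mul, mul_assoc, ← mul_assoc t', ht't, one_mul, hws, map_one]
    calc W = j t * ((Y * (1 - Ser.const b * j v)) * (j t' * W)) := by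
          rw [hYY, one_mul, ← mul_assoc, jtt', one_mul]
      _ = j t * Y * (j (w * t') * j (t * s)) * (1 - Ser.const b * j v) * j t' * W := by
          rw [e]; simp only [mul_assoc, one_mul]
      _ = _ := by rw [← hD, hZ]; simp only [mul_assoc]
  have hMβ₁ : M β₁ = w * M β * (w * t') := map_emb_mul_mul hbi _ _ _
  have hMX₁ : 1 + t * s * u + M α₁ = M X := by
    rw [hX₁, map_add, hM, map_emb hE hbi]
  have hMXinv : (1 - p * u) * M X = 1 := by
    rw [sub_mul, one_mul]; exact sub_eq_of_eq_add hEX'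
  have hfac : M X * (1 - p * q * (v * t')) * (1 + M β₂) = 1 - M α * M β₁ := by
    have e : t * s * (w * t') = 1 := by rw [mul_assoc, ← mul_assoc s, hsw, one_mul, htt']
    calc M X * (1 - p * q * (v * t')) * (1 + M β₂) =
          (M X * (1 - p * q * (v * t')) * t * M Y) * (w * t') := by
          rw [hD']; simp only [mul_assoc]
      _ = t * s * (w * t') - M α * w * M β * (w * t') := by rw [fB, sub_mul]
      _ = _ := by rw [e, hMβ₁]; simp only [mul_assoc]
  -- `E` is only additive and cannot be applied to an infinite sum. The geometric series is
  -- therefore cut after `n` terms, the remainder vanishes in degrees below `n`, and `n` is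
  -- arbitrary.
  have hgoal : M X * (1 - p * q * (v * t')) * M W = M X := by
    refine eq_of_vanishes fun n => ?_
    have hγ : (α * β₁) [] = 0 := by
      change α [] * (S.ι (w []) * β [] * S.ι ((w * t') [])) = 0
      simp [hβ0]
    have hγ' : (M α * M β₁) [] = 0 := by
      change E (α []) * E (S.ι (w []) * β [] * S.ι ((w * t') [])) = 0
      simp [hβ0]
    have hsum : M W = (1 + M β₂) * ∑ i ∈ Finset.range n, (M α * M β₁) ^ i * M X +
        M ((1 + β₂) * ((α * β₁) ^ n * Z)) := by
      conv_lhs => rw [hWZ, eq_geom_add hZX n, mul_add, map_add, Finset.mul_sum, map_sum]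
      congr 1
      rw [Finset.mul_sum]
      refine Finset.sum_congr rfl fun i _ => ?_
      have := h.map_alternating hE hbi hαc hα₁c (hβc.emb_mul_mul w (w * t'))
        (hβc.emb_mul_mul t (w * t')) i (1 + t * s * u)
      rw [← hX₁, ← hM, ← hβ₁, ← hβ₂, hMX₁] at this
      simpa only [mul_assoc] using this
    have hgeom : (1 - M α * M β₁) * ∑ i ∈ Finset.range n, (M α * M β₁) ^ i =
        1 - (M α * M β₁) ^ n := mul_neg_geom_sum _ _
    have hrest : Vanishes n (M ((1 + β₂) * ((α * β₁) ^ n * Z))) := fun l hl => by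
      have := ((Vanishes.pow hγ n).mul_right Z).mul_left (1 + β₂) l hl
      rw [hM, Ser.map_apply, this, map_zero]
    have hfin : M X * (1 - p * q * (v * t')) * M W - M X =
        M X * (1 - p * q * (v * t')) * M ((1 + β₂) * ((α * β₁) ^ n * Z)) -
          (M α * M β₁) ^ n * M X := by
      rw [hsum, ← Finset.sum_mul, mul_add, ← mul_assoc _ (1 + M β₂), hfac, ← mul_assoc, hgeom]
      noncomm_ring
    rw [hfin]
    intro l hl
    rw [Ser.sub_apply, hrest.mul_left _ l hl, (Vanishes.pow hγ' n).mul_right _ l hl, sub_zero]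
  -- `1 - p.u` is a left inverse of `E(X)`, which removes the factor on the left.
  have := congrArg ((1 - p * u) * ·) hgoal
  simp only [← mul_assoc, hMXinv, one_mul] at this
  rw [mul_assoc _ v t', sub_mul, one_mul, sub_eq_iff_eq_add] at this
  exact this

end CondProbSpace

end CFree

/-! ### Multiplicativity of the transform and the main theorem -/

namespace CFree

open Ser

theorem lamInvSharpRho_ser {B : Type*} [Ring B] [Algebra ℂ B] (T : UnitalSeries B) :
    (lamInvSharpRho T).ser = T.ser * I B * T⁻¹.ser := sharp_lam_rho_toFun T

namespace CondProbSpace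

variable {A B : Type*} [Ring A] [Algebra ℂ A] [Ring B] [Algebra ℂ B] (S : CondProbSpace A B)

theorem resolvent_eq (x : A) :
    S.resolvent x = 1 + Ser.const x * S.emb (I B) * S.resolvent x := by
  ext l
  cases l with
  | nil => simp [resolvent, emb, I_nil]
  | cons b l =>
    rw [Ser.add_apply, one_cons, zero_add, mul_assoc, const_mul_apply]
    refine Eq.trans ?_ (congrArg (x * ·) (mapRing_I_mul_cons _ _ b l).symm)
    simp [resolvent, mul_assoc]

theorem compHom_resolvent_eq (x : A) {U : Ser B B} (hU : U [] = 0) :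
    compHom U (S.resolvent x) = 1 + Ser.const x * S.emb U * compHom U (S.resolvent x) := by
  have h := congrArg (compHom U) (S.resolvent_eq x)
  rwa [map_add, map_one, map_mul, map_mul, compHom_const, emb, ← mapRing_compHom,
    compHom_I hU] at h

theorem compHom_resolvent_eq' (x : A) {U : Ser B B} (hU : U [] = 0) :
    compHom U (S.resolvent x) = 1 + compHom U (S.resolvent x) * (Ser.const x * S.emb U) :=
  inv_comm (by simp [emb, hU]) (S.compHom_resolvent_eq x hU)

theorem map_compHom_resolvent (E : A →ₗ[ℂ] B) (x : A) (U : Ser B B) :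
    Ser.map E.toAddMonoidHom (compHom U (S.resolvent x)) = compHom U (S.momentSeries E x) :=
  map_compHom _ _ _

variable {S}

/-- The substitutions are matched so that `map_resolvent_mul` applies with `s = T_b.(1 + I).T_b⁻¹`
and `w = s⁻¹`. The twist by `σ = T_b.I.T_b⁻¹` is what makes `u.t = T_b.v = 1 - w` hold. -/
theorem IsAltMultiplicative.compHom_momentSeries_mul {E : A →ₗ[ℂ] B} (hE : E 1 = 1)
    (hbi : ∀ (b b' : B) (x : A), E (S.ι b * x * S.ι b') = b * E x * b') {a b : A}
    (h : S.IsAltMultiplicative E a b) {Ta Tb Ta' Tb' : UnitalSeries B}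
    (hTa : compHom (I B * Ta⁻¹.ser) (S.cumulantSeries S.ψ a) = Ta.ser)
    (hTb : compHom (I B * Tb⁻¹.ser) (S.cumulantSeries S.ψ b) = Tb.ser)
    (hTa' : compHom (I B * Ta⁻¹.ser) (S.cumulantSeries E a) = Ta'.ser)
    (hTb' : compHom (I B * Tb⁻¹.ser) (S.cumulantSeries E b) = Tb'.ser) :
    compHom (inverseArgument ((Ta <• lamInvSharpRho Tb) * Tb)) (S.momentSeries E (a * b)) =
      1 + ((Ta' <• lamInvSharpRho Tb) * Tb').ser *
          inverseArgument ((Ta <• lamInvSharpRho Tb) * Tb) *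
        compHom (inverseArgument ((Ta <• lamInvSharpRho Tb) * Tb)) (S.momentSeries E (a * b)) := by
  set σ := lamInvSharpRho Tb with hσ
  set t := Ta <• σ with ht
  set p := Ta' <• σ with hp
  set o := onePlusId B with ho
  have hσs : σ.ser = Tb.ser * I B * Tb⁻¹.ser := lamInvSharpRho_ser Tb
  have hoσ : o <• σ = Tb * o * Tb⁻¹ := by
    apply UnitalSeries.ser_injective
    rw [UnitalSeries.act_ser, onePlusId_ser, map_add, map_one, compHom_I σ.ser_nil, hσs,
      UnitalSeries.mul_ser, UnitalSeries.mul_ser, onePlusId_ser, mul_add, mul_one, add_mul,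
      UnitalSeries.ser_mul_inv]
  set v := inverseArgument Tb with hv
  have hv0 : v [] = 0 := inverseArgument_nil Tb
  have hU : inverseArgument (t * Tb) = v * t⁻¹.ser := by
    rw [hv, inverseArgument, inverseArgument, mul_assoc, ← UnitalSeries.mul_ser, mul_inv_rev,
      mul_assoc]
  set u : Ser B B := Tb.ser * v * t⁻¹.ser with hu
  have hu0 : u [] = 0 := by simp [hu, hv0]
  -- Composition with `σ` sends `I` to `T_b.I.T_b⁻¹` and `1 + I` to its conjugate by `T_b`, which
  -- exhibits `v` inside the substitution of `T_a`.
  have huσ : compHom σ.ser (inverseArgument Ta) = u := by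
    have e : compHom σ.ser (o⁻¹ * Ta⁻¹).ser = ((o <• σ)⁻¹ * t⁻¹).ser := by
      rw [← UnitalSeries.act_ser, smul_mul', smul_inv', smul_inv']
    rw [inverseArgument, map_mul, compHom_I σ.ser_nil, e, hoσ, hσs, hu, hv, inverseArgument]
    simp only [mul_assoc, ← UnitalSeries.mul_ser, ← ho]
    congr 3
    group
  have hcomp : ∀ F : A →ₗ[ℂ] B, ∀ T' : UnitalSeries B, compHom (inverseArgument Ta)
      (S.momentSeries F a) = 1 + T'.ser * inverseArgument Ta * compHom (inverseArgument Ta)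
        (S.momentSeries F a) → compHom u (S.momentSeries F a) =
      1 + (T' <• σ).ser * u * compHom u (S.momentSeries F a) := by
    intro F T' hF
    have h' := congrArg (compHom σ.ser) hF
    rwa [map_add, map_one, map_mul, map_mul, compHom_compHom (S.momentSeries_multilinear F a),
      huσ, ← UnitalSeries.act_ser] at h'
  have hEX := hcomp E Ta' (S.compHom_momentSeries hE hbi hTa hTa')
  have hψX := hcomp S.ψ Ta (S.compHom_momentSeries S.ψ_one S.ψ_bimodule hTa hTa)
  have hEY := S.compHom_momentSeries hE hbi hTb hTb'
  have hψY := S.compHom_momentSeries S.ψ_one S.ψ_bimodule hTb hTb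
  simp only [← map_compHom_resolvent] at hEX hψX hEY hψY ⊢
  rw [← hv] at hEY hψY
  rw [← ht] at hψX
  rw [← hp] at hEX
  set X := compHom u (S.resolvent a) with hXdef
  set Y := compHom v (S.resolvent b) with hYdef
  have hX : X = 1 + X * Ser.const a * S.emb u := by
    rw [mul_assoc]; exact S.compHom_resolvent_eq' a hu0
  have hucancel : ∀ f g : Ser B B, f * u = g * u → f = g := by
    intro f g hfg
    have h₁ := congrArg (· * t.ser) hfg
    simp only [hu, mul_assoc, UnitalSeries.inv_ser_mul, mul_one] at h₁
    rw [← mul_assoc, ← mul_assoc] at h₁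
    have h₂ := congrArg (· * Tb⁻¹.ser) (mul_inverseArgument_cancel Tb h₁)
    simpa only [mul_assoc, UnitalSeries.ser_mul_inv, mul_one] using h₂
  -- From `X = 1 + X.a.u` one gets `F(X) = 1 + F(X.a).u`, while `inv_comm` turns the hypothesis into
  -- `F(X) = 1 + F(X).f.u`; then `u` is cancelled.
  have hright : ∀ F : A →ₗ[ℂ] B, F 1 = 1 →
      (∀ (b b' : B) (x : A), F (S.ι b * x * S.ι b') = b * F x * b') → ∀ f : Ser B B,
      Ser.map F.toAddMonoidHom X = 1 + f * u * Ser.map F.toAddMonoidHom X →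
      Ser.map F.toAddMonoidHom (X * Ser.const a) = Ser.map F.toAddMonoidHom X * f := by
    intro F hF hFbi f hf
    apply hucancel
    have h₁ := inv_comm (by simp [hu0]) hf
    have h₂ := congrArg (Ser.map F.toAddMonoidHom) hX
    rw [map_add, map_one_eq hF, map_mul_emb hFbi] at h₂
    rw [mul_assoc]
    exact add_left_cancel (h₂.symm.trans h₁)
  have hut : u * t.ser = 1 - (Tb * o⁻¹ * Tb⁻¹).ser := by
    rw [hu, mul_assoc, UnitalSeries.inv_ser_mul, mul_one, ← one_sub_mul_inverseArgument Tb]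
    abel
  have hψXv : Ser.map S.ψ.toAddMonoidHom X = (t * (Tb * o * Tb⁻¹) * t⁻¹).ser := by
    have e : (t * (Tb * o⁻¹ * Tb⁻¹) * t⁻¹).ser = 1 - t.ser * u := by
      rw [UnitalSeries.mul_ser, UnitalSeries.mul_ser, eq_sub_of_add_eq' (eq_sub_iff_add_eq.1 hut)]
      rw [mul_sub, sub_mul, mul_one, UnitalSeries.ser_mul_inv, mul_assoc, mul_assoc,
        UnitalSeries.ser_mul_inv, mul_one]
    have e' : (t * (Tb * o⁻¹ * Tb⁻¹) * t⁻¹).ser * Ser.map S.ψ.toAddMonoidHom X = 1 := by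
      rw [e, sub_mul, one_mul]; exact sub_eq_of_eq_add hψX
    rw [UnitalSeries.eq_inv_ser e']
    congr 1
    group
  have hψYv : Ser.map S.ψ.toAddMonoidHom Y = (Tb * o * Tb⁻¹).ser := by
    have e' : (Tb * o⁻¹ * Tb⁻¹).ser * Ser.map S.ψ.toAddMonoidHom Y = 1 := by
      rw [← one_sub_mul_inverseArgument, sub_mul, one_mul]; exact sub_eq_of_eq_add hψY
    rw [UnitalSeries.eq_inv_ser e']
    congr 1
    group
  have hsw : (Tb * o * Tb⁻¹).ser * (Tb * o⁻¹ * Tb⁻¹).ser = 1 := by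
    rw [← UnitalSeries.mul_ser, ← UnitalSeries.one_ser]
    congr 1
    group
  have hws : (Tb * o⁻¹ * Tb⁻¹).ser * (Tb * o * Tb⁻¹).ser = 1 := by
    rw [← UnitalSeries.mul_ser, ← UnitalSeries.one_ser]
    congr 1
    group
  rw [hU]
  refine h.map_resolvent_mul hE hbi t.ser_mul_inv t.inv_ser_mul hsw hws hut hv0
    (UnitalSeries.ser_nil _) hX (S.compHom_resolvent_eq b hv0) (S.compHom_resolvent_eq' b hv0)
    (S.compHom_resolvent_eq (a * b) (by simp [hv0])) ((S.resolvent_hasCoeffs a).compHom u)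
    ((S.resolvent_hasCoeffs b).compHom v) ?_ hψYv (hright E hE hbi _ hEX) hEX hEY
  rw [hright S.ψ S.ψ_one S.ψ_bimodule _ hψX, hψXv, ← UnitalSeries.mul_ser, ← UnitalSeries.mul_ser,
    inv_mul_cancel_right]

/-- The product of conditionally free elements of mean one has mean one. -/
theorem IsAltMultiplicative.map_mul_eq_one {E : A →ₗ[ℂ] B} (hE : E 1 = 1) {a b : A}
    (h : S.IsAltMultiplicative E a b) (hψa : S.ψ a = 1) (hψb : S.ψ b = 1) (hEa : E a = 1)
    (hEb : E b = 1) : E (a * b) = 1 := by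
  have := h [(true, a - 1), (false, b - 1)]
    ⟨by simp, by simp, by
      simp only [List.mem_cons, List.not_mem_nil, or_false, forall_eq_or_imp, forall_eq]
      exact ⟨⟨sub_mem (S.self_mem_generated a) (one_mem _), by simp [hψa, S.ψ_one]⟩,
        ⟨sub_mem (S.self_mem_generated b) (one_mem _), by simp [hψb, S.ψ_one]⟩⟩⟩
  simpa [mul_sub, sub_mul, hE, hEa, hEb, sub_eq_zero] using this

theorem CondFree.isCondTTransform_mul {a b : A} (hab : S.CondFree a b) (hψa : S.ψ a = 1)
    (hψb : S.ψ b = 1) (hφa : S.φ a = 1) (hφb : S.φ b = 1)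
    {ta tb : UnitalSeries B × UnitalSeries B} (hta : S.IsCondTTransform a ta)
    (htb : S.IsCondTTransform b tb) :
    S.IsCondTTransform (a * b) ((ta.1 <• lamInvSharpRho tb.1) * tb.1,
      (ta.2 <• lamInvSharpRho tb.1) * tb.2) := by
  have hψ := hab.isAltMultiplicative_ψ
  have hφ : S.IsAltMultiplicative S.φ a b := hab.2
  rw [S.isCondTTransform_iff hψa hφa] at hta
  rw [S.isCondTTransform_iff hψb hφb] at htb
  rw [S.isCondTTransform_iff (hψ.map_mul_eq_one S.ψ_one hψa hψb hψa hψb)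
    (hφ.map_mul_eq_one S.φ_one hψa hψb hφa hφb)]
  have h₁ := hψ.compHom_momentSeries_mul S.ψ_one S.ψ_bimodule hta.1 htb.1 hta.1 htb.1
  have h₂ := hφ.compHom_momentSeries_mul S.φ_one S.φ_bimodule hta.1 htb.1 hta.2 htb.2
  -- The equation for `ψ` is used for both components, since it determines the substitution in which
  -- `K` and `Kᶜ` are evaluated.
  exact ⟨S.compHom_cumulantSeries S.ψ_one S.ψ_bimodule h₁ h₁,
    S.compHom_cumulantSeries S.φ_one S.φ_bimodule h₁ h₂⟩

end CondProbSpace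

end CFree

theorem mainTheorem2 {A B : Type*} [Ring A] [Algebra ℂ A] [Ring B] [Algebra ℂ B]
    (S : CFree.CondProbSpace A B) (a b : A) (hab : S.CondFree a b)
    (hψa : S.ψ a = 1) (hψb : S.ψ b = 1) (hφa : S.φ a = 1) (hφb : S.φ b = 1) :
    (∃! t, S.IsCondTTransform a t) ∧
    (∃! t, S.IsCondTTransform b t) ∧
    (∃! t, S.IsCondTTransform (a * b) t) ∧
    ∀ ta tb tab : CFree.UnitalSeries B × CFree.UnitalSeries B,
      S.IsCondTTransform a ta → S.IsCondTTransform b tb → S.IsCondTTransform (a * b) tab →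
        (⟨tab.1, tab.2⟩ : CFree.Crossed (CFree.lamInvSharpRho (B := B))) =
          ⟨ta.1, ta.2⟩ * ⟨tb.1, tb.2⟩ ∧
        tab.1 = CFree.lamInvSharpRho.star ta.1 tb.1 ∧
        tab.2 = (ta.2 <• CFree.lamInvSharpRho tb.1) * tb.2 := by
  have hφ : S.IsAltMultiplicative S.φ a b := hab.2
  have hu := S.existsUnique_isCondTTransform
    (hab.isAltMultiplicative_ψ.map_mul_eq_one S.ψ_one hψa hψb hψa hψb)
    (hφ.map_mul_eq_one S.φ_one hψa hψb hφa hφb)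
  refine ⟨S.existsUnique_isCondTTransform hψa hφa, S.existsUnique_isCondTTransform hψb hφb, hu,
    fun ta tb tab hta htb htab => ?_⟩
  obtain rfl := hu.unique htab (hab.isCondTTransform_mul hψa hψb hφa hφb hta htb)
  exact ⟨rfl, rfl, rfl⟩
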